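/- Let $L/K$ be a cyclic Galois extension of fields of degree $n=2t$, let $\sigma$ be a generator of $\mathrm{Gal}(L/K)$, let $R=L[x;\sigma]$ be the skew polynomial ring (in which $xa=\sigma(a)x$ for $a\in L$), and let $L'$ be the intermediate field with $[L:L']=2$. Let $k\ge 1$ be an integer. (1) Let $F(y)\in K[y]$ be monic irreducible of degree $s$ with $F(y)\neq y$ and constant coefficient $F_0$. Then $F(x^n)$ is central in $R$; suppose that it is a product of $m$ irreducible elements of $R$, and let $f$ be a monic irreducible factor of $F(x^n)$ in $R$ with $f\notin Z(R)$. Let $\mathcal E(f)=\{g\in R: fg\in Rf\}/Rf$ be the eigenring of $f$, acting on $R/Rf$ by right multiplication. Then $m$ divides $n$. Put $\ell=n/m$. Suppose that $k<m$ and that $\gamma\in L\setminus L'$ is such that $(-1)^{sk\ell}F_0^{k\ell}\,\mathrm N_{L/K}(\gamma)$ is not a square in $K$. Then $\mathcal E(f)$ is a division ring of finite dimension over $K$; there is a $K$-algebra isomorphism $R/RF(x^n)\cong M_m(\mathcal E(f))$ that sends the class of $a$ to the matrix of the left multiplication by $a$ on $R/Rf$ with respect to some basis of the right $\mathcal E(f)$-vector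 space $R/Rf$; and under every $K$-algebra isomorphism $R/RF(x^n)\cong M_m(\mathcal E(f))$ the set $$D_{n,s\ell,k}(\gamma,F)=\Big\{a_0'+\sum_{i=1}^{sk\ell-1}a_ix^i+\gamma a_0''x^{sk\ell}+RF(x^n)\;:\;a_i\in L,\ a_0',a_0''\in L'\Big\}$$ corresponds to a $K$-linear MRD code in $M_m(\mathcal E(f))$ with minimum distance $d=m-k+1$. That is, it is a $K$-subspace $C$ with $d=\min\{\mathrm{rk}(A-B): A,B\in C,\ A\ne B\}$, where the rank of a matrix is the dimension of the right $\mathcal E(f)$-vector space generated by its columns, and $\dim_K C=m(m-d+1)[\mathcal E(f):K]$. (2) The family contains the Trombetti–Zhou codes as the case $F(y)=y-1$: if $k<n$ and $\gamma\in L$ is such that $\mathrm N_{L/K}(\gamma)$ is not a square in $K$, then $\gamma\notin L'$; the element $F(x^n)=x^n-1$ is a product of $n$ irreducible elements of $R$ (so $m=n$ and $s=\ell=1$); the element $(-1)^{k}F_0^{k}\,\mathrm N_{L/K}(\gamma)$ is not a square in $K$; and $D_{n,1,k}(\gamma,y-1)$ is the Trombetti–Zhou set $\{a_0'+\sum_{i=1}^{k-1}a_ix^i+\gamma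 a_0''x^k : a_i\in L,\ a_0',a_0''\in L'\}$ in $R/R(x^n-1)$. -/

import Mathlib

noncomputable section

/-! ### Eigenrings -/

section Eigenring

variable (K : Type*) {A : Type*} [CommRing K] [Ring A] [Algebra K A]

/-- The idealiser `I(f) = {g ∈ A : f g ∈ A f}` of `f`, the largest subring of `A` in which the left
ideal `A f` is two-sided. In Mathlib, `Ideal A` is the type of left ideals of `A`, so that
`Ideal.span {f}` is `A f`. -/
def idealiser (f : A) : Subalgebra K A where
  carrier := {g | f * g ∈ Ideal.span {f}}
  mul_mem' := by
    intro a b ha hb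
    obtain ⟨u, hu⟩ := Ideal.mem_span_singleton'.1 ha
    change f * (a * b) ∈ Ideal.span {f}
    rw [← mul_assoc, ← hu, mul_assoc]
    exact Ideal.mul_mem_left _ _ hb
  add_mem' := by
    intro a b ha hb
    change f * (a + b) ∈ Ideal.span {f}
    rw [mul_add]
    exact Ideal.add_mem _ ha hb
  algebraMap_mem' := by
    intro r
    change f * algebraMap K A r ∈ Ideal.span {f}
    rw [← Algebra.commutes]
    exact Ideal.mul_mem_left _ _ (Ideal.mem_span_singleton_self f)

/-- `A f` as an ideal of the idealiser `I(f)`. -/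
def idealiserIdeal (f : A) : Ideal (idealiser K f) :=
  (Ideal.span {f}).comap (idealiser K f).toSubring.subtype

theorem mem_idealiserIdeal (f : A) (g : idealiser K f) :
    g ∈ idealiserIdeal K f ↔ (g : A) ∈ Ideal.span {f} := Iff.rfl

instance idealiserIdeal_isTwoSided (f : A) : (idealiserIdeal K f).IsTwoSided where
  mul_mem_of_left := by
    intro a b ha
    rw [mem_idealiserIdeal] at ha ⊢
    obtain ⟨u, hu⟩ := Ideal.mem_span_singleton'.1 ha
    rw [MulMemClass.coe_mul, ← hu, mul_assoc]
    exact Ideal.mul_mem_left _ _ b.2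

/-- The eigenring `𝓔(f) = I(f) / A f`. -/
abbrev Eigenring (f : A) : Type _ := idealiser K f ⧸ idealiserIdeal K f

/-- The left `A`-module `A / A f`. -/
abbrev CyclicModule (f : A) : Type _ := A ⧸ Ideal.span {f}

/-- Right multiplication by an element of `I(f)` on `A / A f`. -/
def rightMul (f : A) (g : idealiser K f) : CyclicModule f →ₗ[A] CyclicModule f :=
  Submodule.mapQ _ _ (LinearMap.toSpanSingleton A A (g : A)) (by
    intro a ha
    obtain ⟨u, rfl⟩ := Ideal.mem_span_singleton'.1 ha
    change u * f * (g : A) ∈ Ideal.span {f}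
    rw [mul_assoc]
    exact Ideal.mul_mem_left _ _ g.2)

theorem rightMul_mk (f : A) (g : idealiser K f) (v : A) :
    rightMul K f g (Submodule.Quotient.mk v) = Submodule.Quotient.mk (v * (g : A)) := rfl

/-- Right multiplication on `A / A f`, as a ring homomorphism from `I(f)` to the opposite of the
endomorphism ring. -/
def rightMulHom (f : A) : idealiser K f →+* (Module.End A (CyclicModule f))ᵐᵒᵖ where
  toFun g := MulOpposite.op (rightMul K f g)
  map_one' := by
    apply MulOpposite.unop_injective
    ext
    simp [rightMul_mk]
  map_zero' := by
    apply MulOpposite.unop_injective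
    ext
    simp [rightMul_mk]
  map_mul' a b := by
    apply MulOpposite.unop_injective
    ext
    simp [rightMul_mk]
  map_add' a b := by
    apply MulOpposite.unop_injective
    ext
    simp [rightMul_mk, mul_add]

/-- The eigenring acts on `A / A f` by right multiplication. -/
def eigenringHom (f : A) : Eigenring K f →+* (Module.End A (CyclicModule f))ᵐᵒᵖ :=
  Ideal.Quotient.lift _ (rightMulHom K f) (by
    intro g hg
    rw [mem_idealiserIdeal] at hg
    apply MulOpposite.unop_injective
    refine LinearMap.ext fun v => ?_
    obtain ⟨v, rfl⟩ := Submodule.Quotient.mk_surjective _ v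
    change Submodule.Quotient.mk (v * (g : A)) = (0 : CyclicModule f)
    exact (Submodule.Quotient.mk_eq_zero _).2 (Ideal.mul_mem_left _ _ hg))

/-- `A / A f` as a right `𝓔(f)`-module, i.e. as a module over the opposite ring of `𝓔(f)`. -/
instance eigenringModule (f : A) : Module (Eigenring K f)ᵐᵒᵖ (CyclicModule f) :=
  Module.compHom (CyclicModule f)
    ((RingEquiv.opOp (Module.End A (CyclicModule f))).symm.toRingHom.comp
      (RingHom.op (eigenringHom K f)))

theorem eigenring_smul_mk (f : A) (g : idealiser K f) (v : A) :
    (MulOpposite.op (Ideal.Quotient.mk (idealiserIdeal K f) g) : (Eigenring K f)ᵐᵒᵖ) •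
      (Submodule.Quotient.mk v : CyclicModule f) = Submodule.Quotient.mk (v * (g : A)) := rfl

end Eigenring

/-! ### Rank-metric codes -/

section RankMetric

/-- The rank of a matrix over a division ring `D`: the dimension of the right `D`-vector space
generated by its columns. Right `D`-modules are modules over the opposite ring of `D`. -/
def rightRank {D : Type*} [Ring D] {m : ℕ} (M : Matrix (Fin m) (Fin m) D) : ℕ :=
  Module.finrank Dᵐᵒᵖ (Submodule.span Dᵐᵒᵖ (Set.range M.col))

/-- `d` is the minimum distance `min {rk (M - N) : M, N ∈ C, M ≠ N}` of the code `C`. -/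
def IsMinDistance {D : Type*} [Ring D] {m : ℕ} (C : Set (Matrix (Fin m) (Fin m) D)) (d : ℕ) :
    Prop :=
  IsLeast {r | ∃ M ∈ C, ∃ N ∈ C, M ≠ N ∧ r = rightRank (M - N)} d

/-- `C` is a `K`-linear MRD code in `M_m(D)` with minimum distance `d`: it is a `K`-subspace with
minimum distance `d` that attains the Singleton-like bound
`dim_K C ≤ m (m - d + 1) [D : K]`, where `D` is a division ring of finite dimension over `K`. -/
structure IsLinearMRDCode (K : Type*) {D : Type*} [Field K] [Ring D] [Algebra K D] {m : ℕ}
    (C : Set (Matrix (Fin m) (Fin m) D)) (d : ℕ) : Prop where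
  nontrivial : Nontrivial D
  isUnit : ∀ a : D, a ≠ 0 → IsUnit a
  finite : Module.Finite K D
  linear : ∃ W : Submodule K (Matrix (Fin m) (Fin m) D),
    (W : Set (Matrix (Fin m) (Fin m) D)) = C ∧
      Module.finrank K W = m * (m - d + 1) * Module.finrank K D
  minDistance : IsMinDistance C d

end RankMetric

/-! ### Skew polynomial rings -/

section Skew

variable {K L : Type*} [Field K] [Field L] [Algebra K L]

/-- A copy of `L` on which the monoid of powers of the indeterminate acts through `σ`. -/
def SkewCoeff (_σ : L ≃ₐ[K] L) : Type _ := L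

instance (σ : L ≃ₐ[K] L) : Field (SkewCoeff σ) := inferInstanceAs (Field L)

instance (σ : L ≃ₐ[K] L) : Algebra K (SkewCoeff σ) := inferInstanceAs (Algebra K L)

/-- The identity map from `L` to its copy. -/
def toCoeff (σ : L ≃ₐ[K] L) : L ≃ₐ[K] SkewCoeff σ := (AlgEquiv.refl : L ≃ₐ[K] L)

instance (σ : L ≃ₐ[K] L) : MulSemiringAction (Multiplicative ℕ) (SkewCoeff σ) where
  smul i a := toCoeff σ ((σ ^ i.toAdd) ((toCoeff σ).symm a))
  one_smul _ := rfl
  mul_smul i j a := by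
    change toCoeff σ ((σ ^ (i.toAdd + j.toAdd)) ((toCoeff σ).symm a)) = _
    rw [pow_add]
    rfl
  smul_zero i := map_zero (σ ^ i.toAdd)
  smul_add i := map_add (σ ^ i.toAdd)
  smul_one i := map_one (σ ^ i.toAdd)
  smul_mul i := map_mul (σ ^ i.toAdd)

theorem skew_smul_def (σ : L ≃ₐ[K] L) (i : ℕ) (a : L) :
    Multiplicative.ofAdd i • toCoeff σ a = toCoeff σ ((σ ^ i) a) := rfl

instance (σ : L ≃ₐ[K] L) : SMulCommClass (Multiplicative ℕ) K (SkewCoeff σ) where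
  smul_comm i c a := map_smul (σ ^ i.toAdd) c ((toCoeff σ).symm a)

/-- The skew polynomial ring `R = L[x; σ]`, in which `x a = σ(a) x`. -/
abbrev SkewPoly (σ : L ≃ₐ[K] L) : Type _ := SkewPolynomial (SkewCoeff σ)

namespace SkewPoly

/-- The monomial `a x ^ i`. -/
def mono (σ : L ≃ₐ[K] L) (i : ℕ) (a : L) : SkewPoly σ :=
  SkewPolynomial.monomial i (toCoeff σ a)

theorem mono_mul_mono (σ : L ≃ₐ[K] L) (i j : ℕ) (a b : L) :
    mono σ i a * mono σ j b = mono σ (i + j) (a * (σ ^ i) b) := by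
  unfold mono
  rw [SkewPolynomial.monomial_mul_monomial, SkewPolynomial.φ_iterate_apply, skew_smul_def,
    map_mul (toCoeff σ)]

/-- A skew polynomial is monic if its leading coefficient is `1`. -/
def IsMonic {σ : L ≃ₐ[K] L} (f : SkewPoly σ) : Prop :=
  ∃ d : ℕ, SkewPolynomial.coeff f d = 1 ∧ ∀ i, d < i → SkewPolynomial.coeff f i = 0

/-- The element `F(x ^ n)` of `R`, where `n = [L : K]`. -/
def central (σ : L ≃ₐ[K] L) (F : Polynomial K) : SkewPoly σ :=
  Polynomial.aeval (mono σ (Module.finrank K L) 1) F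

theorem pow_finrank_eq_one [FiniteDimensional K L] [IsGalois K L] (σ : L ≃ₐ[K] L) :
    σ ^ Module.finrank K L = 1 := by
  rw [← IsGalois.card_aut_eq_finrank]
  exact pow_card_eq_one'

theorem central_mul_comm [FiniteDimensional K L] [IsGalois K L] (σ : L ≃ₐ[K] L)
    (F : Polynomial K) (g : SkewPoly σ) : central σ F * g = g * central σ F := by
  have h : ∀ g : SkewPoly σ, Commute (mono σ (Module.finrank K L) 1) g := by
    intro g
    induction g using SkewPolynomial.induction with
    | h0 => exact Commute.zero_right _
    | ha i r q _ _ hq =>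
      refine Commute.add_right ?_ hq
      have : SkewPolynomial.monomial i r = mono σ i ((toCoeff σ).symm r) := rfl
      rw [this]
      change _ * _ = _ * _
      rw [mono_mul_mono, mono_mul_mono, pow_finrank_eq_one, add_comm]
      simp
  have : central σ F ∈ Subalgebra.centralizer K ({g} : Set (SkewPoly σ)) := by
    refine Algebra.adjoin_le (Set.singleton_subset_iff.2 ?_)
      (Polynomial.aeval_mem_adjoin_singleton K (mono σ (Module.finrank K L) 1))
    rw [SetLike.mem_coe]
    rw [Subalgebra.mem_centralizer_iff]
    rintro _ rfl
    exact (h _).eq.symm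
  exact ((Subalgebra.mem_centralizer_iff K).1 this g rfl).symm

instance [FiniteDimensional K L] [IsGalois K L] (σ : L ≃ₐ[K] L) (F : Polynomial K) :
    (Ideal.span {central σ F}).IsTwoSided where
  mul_mem_of_left := by
    intro a b ha
    obtain ⟨u, rfl⟩ := Ideal.mem_span_singleton'.1 ha
    rw [mul_assoc, central_mul_comm, ← mul_assoc]
    exact Ideal.mul_mem_left _ _ (Ideal.mem_span_singleton_self _)

/-- The quotient ring `R_F = R / R F(x ^ n)`. -/
abbrev Quot (σ : L ≃ₐ[K] L) (F : Polynomial K) : Type _ :=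
  SkewPoly σ ⧸ Ideal.span {central σ F}

/-- `a` is a product of `m` irreducible elements of the ring `R`. -/
def IsProductOfIrreducibles {R : Type*} [Ring R] (a : R) (m : ℕ) : Prop :=
  ∃ l : List R, l.length = m ∧ (∀ g ∈ l, Irreducible g) ∧ l.prod = a

/-- The skew polynomials `a' + ∑_{0 < i < N} a_i x ^ i + γ a'' x ^ N` with `a_i ∈ L` and
`a', a'' ∈ L'`. -/
def polys (σ : L ≃ₐ[K] L) (L' : IntermediateField K L) (N : ℕ) (γ : L) : Set (SkewPoly σ) :=
  {g | ∃ (a : ℕ → L) (a' a'' : L'),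
    g = mono σ 0 a' + ∑ i ∈ Finset.Ico 1 N, mono σ i (a i) + mono σ N (γ * a'')}

/-- The set `D_{n, sℓ, k}(γ, F) ⊆ R / R F(x ^ n)` of the classes of the skew polynomials
`a' + ∑_{0 < i < skℓ} a_i x ^ i + γ a'' x ^ (skℓ)`, where `s = deg F` and `n = [L : K]`. -/
def codeD (σ : L ≃ₐ[K] L) (L' : IntermediateField K L) (F : Polynomial K) (ℓ k : ℕ) (γ : L) :
    Set (Quot σ F) :=
  Submodule.Quotient.mk '' polys σ L' (F.natDegree * k * ℓ) γ

/-- The Trombetti-Zhou set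
`{a' + ∑_{0 < i < k} a_i x ^ i + γ a'' x ^ k : a_i ∈ L, a', a'' ∈ L'} ⊆ R / R (x ^ n - 1)`,
where `n = [L : K]`. -/
def trombettiZhou (σ : L ≃ₐ[K] L) (L' : IntermediateField K L) (k : ℕ) (γ : L) :
    Set (SkewPoly σ ⧸ Ideal.span {(SkewPolynomial.X ^ Module.finrank K L - 1 : SkewPoly σ)}) :=
  {c | ∃ (a : ℕ → L) (a' a'' : L'),
    c = Submodule.Quotient.mk
      (mono σ 0 a' + ∑ i ∈ Finset.Ico 1 k, mono σ i (a i) + mono σ k (γ * a''))}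

/-- `Φ` is a canonical isomorphism `R / R F(x ^ n) ≅ M_m(𝓔(f))`: there is a basis `b` of the right
`𝓔(f)`-vector space `R / R f` such that `Φ` maps the class of `a` to the matrix, with respect to
`b`, of the left multiplication by `a` on `R / R f`. -/
def IsCanonical [FiniteDimensional K L] [IsGalois K L] {σ : L ≃ₐ[K] L} {F : Polynomial K}
    {f : SkewPoly σ} {m : ℕ} (Φ : Quot σ F ≃ₐ[K] Matrix (Fin m) (Fin m) (Eigenring K f)) : Prop :=
  ∃ b : Module.Basis (Fin m) (Eigenring K f)ᵐᵒᵖ (CyclicModule f),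
    ∀ (a : SkewPoly σ) (j : Fin m),
      a • b j = ∑ i, MulOpposite.op (Φ (Submodule.Quotient.mk a) i j) • b i

end SkewPoly

end Skew

end

/-! Write `R_F = R / R F(x ^ n)`. A monic element `h` of least degree in a two-sided ideal of `R`,
with nonzero constant coefficient, has the form `G(x ^ n)` with `G ∈ K[y]`. As `F` is irreducible
and `F_0 ≠ 0`, it follows that `R F(x ^ n)` is the only proper two-sided ideal containing `F(x ^ n)`
(`eq_span_central_of_twoSided`), so it is the annihilator of the simple module `R / R f`. The
endomorphism ring of `R / R f` is the opposite of `𝓔(f)`, and Jacobson density gives `R_F ≅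
M_q(𝓔(f))`, where `q` is the dimension of `R / R f` over `𝓔(f)`. As a left module `R_F` is the
`q`-th power of `R / R f`, so comparing lengths gives `q = m`. The `K`-dimensions then satisfy `m ^
2 [𝓔(f) : K] = s n ^ 2`; since the class of `x ^ n` is a root of `F` in `𝓔(f)`, `s` divides `[𝓔(f) :
K]`. Hence `m ∣ n` and `[𝓔(f) : K] = s ℓ ^ 2` (`eigenring_dimensions`).

The code has `K`-dimension `n s k ℓ = m k [𝓔(f) : K]`, so by a Singleton argument it contains a
nonzero matrix of rank at most `m - k + 1`. The point is that no nonzero codeword `a` has rank at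
most `m - k` (`lt_rightRank_of_mem_polys`). The right ideal `a R_F` has `K`-dimension `m · rk(a) ·
[𝓔(f) : K]`, which does not depend on the isomorphism with the matrix ring. If `rk(a) ≤ m - k`, then
`R_F / a R_F` has dimension at least `n s k ℓ`. It is a quotient of `R / a R`, whose dimension is at
most `n deg a ≤ n s k ℓ`. Equality holds throughout, so `deg a = s k ℓ` and `F(x ^ n) ∈ a R`.

The reduced norm of such an `a` divides `F ^ n` in `K[X]`, hence is a scalar multiple of `F ^ (k
ℓ)`. Its constant and leading coefficients are `N(a_0)` and `(-1) ^ (s k ℓ) N(a_{s k ℓ})`, because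
`n` is even (`norm_cf_zero_of_mul_eq_central`). With `a_0 = a'` and `a_{s k ℓ} = γ a''`, where `a',
a'' ∈ L'`, the norms of `a'` and `a''` are squares in `K`, so `(-1) ^ (s k ℓ) F_0 ^ (k ℓ) N(γ)`
would be a square. -/

noncomputable section

namespace SkewPoly

/-! ### Coefficients, degree, and division with remainder in `L[x; σ]` -/

section Basic

variable {K L : Type*} [Field K] [Field L] [Algebra K L] {σ : L ≃ₐ[K] L}

/-- The coefficient of `x ^ i`, as an element of `L`. -/
def cf (i : ℕ) : SkewPoly σ →ₗ[K] L where
  toFun g := (toCoeff σ).symm (SkewPolynomial.coeff g i)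
  map_add' g h := by rw [SkewPolynomial.coeff_add, map_add]
  map_smul' c g := by
    change (toCoeff σ).symm (c • SkewPolynomial.coeff g i) = _
    rw [map_smul]; rfl

theorem cf_apply (i : ℕ) (g : SkewPoly σ) :
    cf i g = (toCoeff σ).symm (SkewPolynomial.coeff g i) := rfl

theorem coeff_eq_cf (i : ℕ) (g : SkewPoly σ) :
    SkewPolynomial.coeff g i = toCoeff σ (cf i g) := rfl

theorem ext_cf {g h : SkewPoly σ} (H : ∀ i, cf i g = cf i h) : g = h :=
  SkewPolynomial.ext fun i => (toCoeff σ).symm.injective (H i)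

theorem cf_mono (i j : ℕ) (a : L) : cf i (mono σ j a) = if j = i then a else 0 := by
  rw [cf_apply, mono, SkewPolynomial.coeff_monomial]
  split_ifs
  · rfl
  · exact map_zero _

@[simp] theorem cf_mono_self (i : ℕ) (a : L) : cf i (mono σ i a) = a := by simp [cf_mono]

theorem cf_mono_ne {i j : ℕ} (h : j ≠ i) (a : L) : cf i (mono σ j a) = 0 := by simp [cf_mono, h]

theorem mono_zero_one : mono σ 0 1 = 1 := rfl

theorem cf_one (i : ℕ) : cf i (1 : SkewPoly σ) = if 0 = i then 1 else 0 := by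
  rw [← mono_zero_one, cf_mono]

/-- The monomials of degree `i`, as a linear map. -/
def monoₗ (σ : L ≃ₐ[K] L) (i : ℕ) : L →ₗ[K] SkewPoly σ where
  toFun := mono σ i
  map_add' a b := ext_cf fun j => by simp only [map_add, cf_mono]; split_ifs <;> simp
  map_smul' c a := ext_cf fun j => by simp only [map_smul, cf_mono]; split_ifs <;> simp

theorem monoₗ_apply (i : ℕ) (a : L) : monoₗ σ i a = mono σ i a := rfl

theorem cf_mul (k : ℕ) (g h : SkewPoly σ) :
    cf k (g * h) = ∑ p ∈ Finset.HasAntidiagonal.antidiagonal k, cf p.1 g * (σ ^ p.1) (cf p.2 h) := by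
  have key := SkewMonoidAlgebra.coeff_mul_antidiagonal_of_finset g h (Multiplicative.ofAdd k)
    ((Finset.HasAntidiagonal.antidiagonal k).map
      (Multiplicative.ofAdd.prodCongr Multiplicative.ofAdd).toEmbedding) (by
      rintro ⟨a, b⟩
      rw [Finset.mem_map_equiv, Finset.HasAntidiagonal.mem_antidiagonal]
      rfl)
  rw [Finset.sum_map] at key
  rw [cf_apply]
  change (toCoeff σ).symm (SkewMonoidAlgebra.coeff (g * h) (Multiplicative.ofAdd k)) = _
  rw [key, map_sum]
  rfl

theorem exists_cf_eq_zero (g : SkewPoly σ) : ∃ N, ∀ i, N ≤ i → cf i g = 0 := by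
  refine ⟨(SkewPolynomial.support g).sup id + 1, fun i hi => ?_⟩
  by_contra h
  have : i ∈ SkewPolynomial.support g := by
    rw [SkewPolynomial.mem_support_iff, coeff_eq_cf]
    simpa using h
  have := Finset.le_sup (f := id) this
  simp only [id] at this
  omega

variable (σ) in
/-- The skew polynomials of degree less than `N`. -/
def degLT (N : ℕ) : Submodule K (SkewPoly σ) where
  carrier := {g | ∀ i, N ≤ i → cf i g = 0}
  add_mem' ha hb i hi := by rw [map_add, ha i hi, hb i hi, add_zero]
  zero_mem' i _ := map_zero _
  smul_mem' c g hg i hi := by rw [map_smul, hg i hi, smul_zero]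

theorem degLT_mono {M N : ℕ} (h : M ≤ N) : degLT σ M ≤ degLT σ N :=
  fun _ hg i hi => hg i (h.trans hi)

theorem mono_mem_degLT {i N : ℕ} (h : i < N) (a : L) : mono σ i a ∈ degLT σ N :=
  fun j hj => cf_mono_ne (by omega) a

theorem exists_mem_degLT (g : SkewPoly σ) : ∃ N, g ∈ degLT σ N := exists_cf_eq_zero g

theorem eq_zero_of_mem_degLT_zero {g : SkewPoly σ} (h : g ∈ degLT σ 0) : g = 0 :=
  ext_cf fun i => by rw [h i (Nat.zero_le i), map_zero]

theorem mem_degLT_of_succ {N : ℕ} {g : SkewPoly σ} (h : g ∈ degLT σ (N + 1)) (h0 : cf N g = 0) :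
    g ∈ degLT σ N := fun i hi => by
  rcases hi.eq_or_lt with rfl | hi
  · exact h0
  · exact h i hi

theorem eq_sum_mono {N : ℕ} {g : SkewPoly σ} (h : g ∈ degLT σ N) :
    g = ∑ i ∈ Finset.range N, mono σ i (cf i g) := ext_cf fun j => by
  rw [map_sum]
  simp_rw [cf_mono]
  rw [Finset.sum_ite_eq']
  split_ifs with hj
  · rfl
  · exact h j (by simpa using hj)

/-- Coefficients identify skew polynomials of degree less than `N` with `N`-tuples. -/
def degLTEquiv (σ : L ≃ₐ[K] L) (N : ℕ) : degLT σ N ≃ₗ[K] (Fin N → L) where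
  toFun g i := cf i (g : SkewPoly σ)
  map_add' g h := by ext i; exact map_add _ _ _
  map_smul' c g := by ext i; exact map_smul _ _ _
  invFun v := ⟨∑ i : Fin N, mono σ i (v i),
    Submodule.sum_mem _ fun i _ => mono_mem_degLT i.2 _⟩
  left_inv g := by
    apply Subtype.ext
    conv_rhs => rw [eq_sum_mono g.2, Finset.sum_range]
  right_inv v := by
    ext i
    simp only [map_sum, cf_mono]
    rw [Finset.sum_eq_single i]
    · simp
    · intro j _ hj
      rw [if_neg]
      exact fun h => hj (Fin.ext h)
    · simp

theorem finrank_degLT [FiniteDimensional K L] (N : ℕ) :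
    Module.finrank K (degLT σ N) = Module.finrank K L * N := by
  rw [(degLTEquiv σ N).finrank_eq, Module.finrank_pi_fintype]
  simp [mul_comm]

instance [FiniteDimensional K L] (N : ℕ) : Module.Finite K (degLT σ N) :=
  Module.Finite.equiv (degLTEquiv σ N).symm

/-- `g` has degree exactly `d`. -/
def HasDeg (g : SkewPoly σ) (d : ℕ) : Prop := cf d g ≠ 0 ∧ g ∈ degLT σ (d + 1)

theorem exists_hasDeg_lt {N : ℕ} {g : SkewPoly σ} (h : g ∈ degLT σ N) (h0 : g ≠ 0) :
    ∃ d < N, HasDeg g d := by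
  induction N with
  | zero => exact absurd (eq_zero_of_mem_degLT_zero h) h0
  | succ N ih =>
    by_cases hN : cf N g = 0
    · obtain ⟨d, hd, hg⟩ := ih (mem_degLT_of_succ h hN)
      exact ⟨d, by omega, hg⟩
    · exact ⟨N, by omega, hN, h⟩

theorem exists_hasDeg {g : SkewPoly σ} (h0 : g ≠ 0) : ∃ d, HasDeg g d := by
  obtain ⟨N, hN⟩ := exists_mem_degLT g
  obtain ⟨d, -, h⟩ := exists_hasDeg_lt hN h0
  exact ⟨d, h⟩

theorem HasDeg.ne_zero {g : SkewPoly σ} {d : ℕ} (h : HasDeg g d) : g ≠ 0 := by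
  rintro rfl
  exact h.1 (map_zero _)

theorem HasDeg.lt_of_mem {g : SkewPoly σ} {d N : ℕ} (h : HasDeg g d) (hg : g ∈ degLT σ N) :
    d < N := by
  by_contra hN
  exact h.1 (hg d (by omega))

theorem HasDeg.unique {g : SkewPoly σ} {d e : ℕ} (h : HasDeg g d) (h' : HasDeg g e) : d = e := by
  have h1 := h.lt_of_mem h'.2
  have h2 := h'.lt_of_mem h.2
  omega

theorem mul_mem_degLT {g h : SkewPoly σ} {d e : ℕ} (hg : g ∈ degLT σ (d + 1))
    (hh : h ∈ degLT σ (e + 1)) : g * h ∈ degLT σ (d + e + 1) := by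
  intro k hk
  rw [cf_mul]
  refine Finset.sum_eq_zero fun p hp => ?_
  rw [Finset.HasAntidiagonal.mem_antidiagonal] at hp
  rcases Nat.lt_or_ge d p.1 with h1 | h1
  · rw [hg _ h1, zero_mul]
  · rw [hh p.2 (by omega), map_zero, mul_zero]

theorem cf_add_mul {g h : SkewPoly σ} {d e : ℕ} (hg : g ∈ degLT σ (d + 1))
    (hh : h ∈ degLT σ (e + 1)) : cf (d + e) (g * h) = cf d g * (σ ^ d) (cf e h) := by
  rw [cf_mul, Finset.sum_eq_single (d, e)]
  · rintro ⟨i, j⟩ hp hne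
    rw [Finset.HasAntidiagonal.mem_antidiagonal] at hp
    dsimp only at hp ⊢
    rcases Nat.lt_or_ge d i with h1 | h1
    · rw [hg _ h1, zero_mul]
    · rw [hh j _, map_zero, mul_zero]
      by_contra hj
      exact hne (by ext <;> simp only <;> omega)
  · intro h
    exact absurd (by rw [Finset.HasAntidiagonal.mem_antidiagonal]) h

theorem HasDeg.mul {g h : SkewPoly σ} {d e : ℕ} (hg : HasDeg g d) (hh : HasDeg h e) :
    HasDeg (g * h) (d + e) := by
  refine ⟨?_, mul_mem_degLT hg.2 hh.2⟩
  rw [cf_add_mul hg.2 hh.2]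
  exact mul_ne_zero hg.1 ((map_ne_zero_iff _ (σ ^ d).injective).2 hh.1)

instance : NoZeroDivisors (SkewPoly σ) where
  eq_zero_or_eq_zero_of_mul_eq_zero {g h} H := by
    by_contra! hne
    obtain ⟨d, hd⟩ := exists_hasDeg hne.1
    obtain ⟨e, he⟩ := exists_hasDeg hne.2
    exact (hd.mul he).ne_zero H

instance : IsDomain (SkewPoly σ) := NoZeroDivisors.to_isDomain _

theorem hasDeg_mono {i : ℕ} {a : L} (ha : a ≠ 0) : HasDeg (mono σ i a) i :=
  ⟨by simpa, mono_mem_degLT (by omega) a⟩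

theorem exists_sub_mul_mem_degLT {h : SkewPoly σ} {d : ℕ} (hh : HasDeg h d) (g : SkewPoly σ) :
    ∃ q, g - q * h ∈ degLT σ d := by
  obtain ⟨N, hN⟩ := exists_mem_degLT g
  induction N generalizing g with
  | zero => exact ⟨0, by simpa using degLT_mono (Nat.zero_le d) hN⟩
  | succ N ih =>
    rcases Nat.lt_or_ge N d with hd | hd
    · exact ⟨0, by simpa using degLT_mono hd hN⟩
    obtain ⟨j, rfl⟩ := Nat.exists_eq_add_of_le' hd
    have hc : (σ ^ j) (cf d h) ≠ 0 := (map_ne_zero_iff _ (σ ^ j).injective).2 hh.1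
    set q := mono σ j (cf (j + d) g / (σ ^ j) (cf d h))
    have hq : q ∈ degLT σ (j + 1) := mono_mem_degLT (by omega) _
    have : g - q * h ∈ degLT σ (j + d) := by
      refine mem_degLT_of_succ (Submodule.sub_mem _ hN (mul_mem_degLT hq hh.2)) ?_
      rw [map_sub, cf_add_mul hq hh.2, cf_mono_self, div_mul_cancel₀ _ hc, sub_self]
    obtain ⟨q', hq'⟩ := ih _ this
    exact ⟨q + q', by rwa [add_mul, ← sub_sub]⟩

theorem exists_sub_mul_mem_degLT' {h : SkewPoly σ} {d : ℕ} (hh : HasDeg h d) (g : SkewPoly σ) :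
    ∃ q, g - h * q ∈ degLT σ d := by
  obtain ⟨N, hN⟩ := exists_mem_degLT g
  induction N generalizing g with
  | zero => exact ⟨0, by simpa using degLT_mono (Nat.zero_le d) hN⟩
  | succ N ih =>
    rcases Nat.lt_or_ge N d with hd | hd
    · exact ⟨0, by simpa using degLT_mono hd hN⟩
    obtain ⟨j, rfl⟩ := Nat.exists_eq_add_of_le hd
    -- Multiplying by `h` on the left twists the coefficient of `q` by `σ ^ d`, so this twist is
    -- undone in advance.
    set q := mono σ j ((σ ^ d).symm (cf (d + j) g / cf d h))
    have hq : q ∈ degLT σ (j + 1) := mono_mem_degLT (by omega) _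
    have : g - h * q ∈ degLT σ (d + j) := by
      refine mem_degLT_of_succ (Submodule.sub_mem _ hN (mul_mem_degLT hh.2 hq)) ?_
      rw [map_sub, cf_add_mul hh.2 hq, cf_mono_self, AlgEquiv.apply_symm_apply,
        mul_div_cancel₀ _ hh.1, sub_self]
    obtain ⟨q', hq'⟩ := ih _ this
    exact ⟨q + q', by rwa [mul_add, ← sub_sub]⟩

/-- Stated for a `K`-subspace because it is applied to the right ideal `a R`, whereas `Ideal` means
left ideal. -/
theorem finite_quotient [FiniteDimensional K L] (S : Submodule K (SkewPoly σ)) {d : ℕ}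
    (hS : ∀ g, ∃ s ∈ S, g - s ∈ degLT σ d) :
    Module.Finite K (SkewPoly σ ⧸ S) ∧
      Module.finrank K (SkewPoly σ ⧸ S) ≤ Module.finrank K L * d := by
  have hsurj : Function.Surjective (S.mkQ ∘ₗ (degLT σ d).subtype) := by
    intro v
    obtain ⟨g, rfl⟩ := S.mkQ_surjective v
    obtain ⟨s, hs, h⟩ := hS g
    refine ⟨⟨_, h⟩, ?_⟩
    simp [(Submodule.Quotient.mk_eq_zero S).2 hs]
  refine ⟨Module.Finite.of_surjective _ hsurj, ?_⟩
  rw [← finrank_degLT (σ := σ)]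
  exact LinearMap.finrank_le_finrank_of_surjective hsurj

theorem eq_zero_of_mul_mem_degLT {h q : SkewPoly σ} {d : ℕ} (hh : HasDeg h d)
    (hq : q * h ∈ degLT σ d) : q = 0 := by
  by_contra h0
  obtain ⟨e, he⟩ := exists_hasDeg h0
  have := (he.mul hh).lt_of_mem hq
  omega

theorem bijective_degLT_quotient {h : SkewPoly σ} {d : ℕ} (hh : HasDeg h d) :
    Function.Bijective (((Ideal.span {h}).restrictScalars K).mkQ ∘ₗ (degLT σ d).subtype) := by
  constructor
  · rw [← LinearMap.ker_eq_bot, LinearMap.ker_eq_bot']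
    intro g hg
    have hg : (g : SkewPoly σ) ∈ Ideal.span {h} := (Submodule.Quotient.mk_eq_zero _).1 hg
    obtain ⟨q, hq⟩ := Ideal.mem_span_singleton'.1 hg
    have h0 : q * h ∈ degLT σ d := by rw [hq]; exact g.2
    rw [eq_zero_of_mul_mem_degLT hh h0, zero_mul] at hq
    exact Subtype.ext hq.symm
  · intro v
    obtain ⟨g, rfl⟩ := Submodule.mkQ_surjective _ v
    obtain ⟨q, hq⟩ := exists_sub_mul_mem_degLT hh g
    refine ⟨⟨_, hq⟩, ?_⟩
    have : q * h ∈ (Ideal.span {h}).restrictScalars K :=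
      Ideal.mul_mem_left _ _ (Ideal.mem_span_singleton_self h)
    simp [(Submodule.Quotient.mk_eq_zero _).2 this]

theorem finrank_cyclicModule [FiniteDimensional K L] {h : SkewPoly σ} {d : ℕ} (hh : HasDeg h d) :
    Module.Finite K (CyclicModule h) ∧
      Module.finrank K (CyclicModule h) = Module.finrank K L * d := by
  let e : degLT σ d ≃ₗ[K] CyclicModule h := LinearEquiv.ofBijective _ (bijective_degLT_quotient hh)
  exact ⟨Module.Finite.equiv e, by rw [← e.finrank_eq, finrank_degLT]⟩

theorem central_eq_sum (F : Polynomial K) : central σ F =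
    F.sum fun i c => mono σ (i * Module.finrank K L) (algebraMap K L c) := by
  rw [central, Polynomial.aeval_eq_sum_range, Polynomial.sum_over_range]
  · refine Finset.sum_congr rfl fun i hi => ?_
    clear hi
    have : mono σ (Module.finrank K L) 1 ^ i = mono σ (i * Module.finrank K L) 1 := by
      induction i with
      | zero => simp [mono_zero_one]
      | succ i ih => rw [pow_succ, ih, mono_mul_mono, map_one, one_mul]; congr 1; ring
    rw [this, ← monoₗ_apply, ← map_smul, monoₗ_apply, Algebra.smul_def, mul_one]
  · intro i
    rw [map_zero, ← monoₗ_apply, map_zero]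

theorem cf_central [FiniteDimensional K L] (F : Polynomial K) (i : ℕ) :
    cf (i * Module.finrank K L) (central σ F) = algebraMap K L (F.coeff i) := by
  have hn : 0 < Module.finrank K L := Module.finrank_pos
  rw [central_eq_sum, Polynomial.sum_def, map_sum]
  simp_rw [cf_mono, Nat.mul_left_inj hn.ne']
  rw [Finset.sum_ite_eq']
  split_ifs with h
  · rfl
  · rw [Polynomial.notMem_support_iff.1 h, map_zero]

theorem cf_central_of_not_dvd (F : Polynomial K) {j : ℕ}
    (hj : ¬ Module.finrank K L ∣ j) : cf j (central σ F) = 0 := by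
  rw [central_eq_sum, Polynomial.sum_def, map_sum]
  refine Finset.sum_eq_zero fun i _ => cf_mono_ne ?_ _
  rintro rfl
  exact hj (Dvd.intro_left i rfl)

theorem central_mem_degLT [FiniteDimensional K L] (F : Polynomial K) :
    central σ F ∈ degLT σ (F.natDegree * Module.finrank K L + 1) := by
  intro j hj
  by_cases h : Module.finrank K L ∣ j
  · obtain ⟨i, rfl⟩ := h
    rw [mul_comm, cf_central, Polynomial.coeff_eq_zero_of_natDegree_lt, map_zero]
    by_contra hi
    have := Nat.mul_le_mul_left (Module.finrank K L) (not_lt.1 hi)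
    rw [mul_comm _ F.natDegree] at this
    omega
  · exact cf_central_of_not_dvd F h

theorem hasDeg_central [FiniteDimensional K L] {F : Polynomial K} (hF : F ≠ 0) :
    HasDeg (central σ F) (F.natDegree * Module.finrank K L) :=
  ⟨by rw [cf_central]; simpa using hF, central_mem_degLT F⟩

end Basic

end SkewPoly


/-! ### Modules over division rings -/

section DivisionRing

/-- The eigenring is only known to be a ring whose nonzero elements are units; a division ring
structure is put on it locally, to import linear algebra. -/
theorem free_of_forall_isUnit {D V : Type*} [Ring D] [Nontrivial D]
    (h : ∀ a : D, a ≠ 0 → IsUnit a) [AddCommGroup V] [Module D V] : Module.Free D V :=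
  letI : DivisionRing D := DivisionRing.ofIsUnitOrEqZero fun a => (em (a = 0)).symm.imp_left (h a)
  Module.Free.of_divisionRing D V

theorem strongRankCondition_of_forall_isUnit {D : Type*} [Ring D] [Nontrivial D]
    (h : ∀ a : D, a ≠ 0 → IsUnit a) : StrongRankCondition D :=
  letI : DivisionRing D := DivisionRing.ofIsUnitOrEqZero fun a => (em (a = 0)).symm.imp_left (h a)
  inferInstance

theorem forall_isUnit_op {D : Type*} [Ring D] (h : ∀ a : D, a ≠ 0 → IsUnit a) (a : Dᵐᵒᵖ)
    (ha : a ≠ 0) : IsUnit a := by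
  have := (h a.unop (by simpa using ha)).op
  simpa using this

end DivisionRing

/-! ### Cyclic modules and eigenrings -/

section Cyclic

variable {A : Type*} [Ring A]

/-- Right multiplication by `h` gives the exact sequence `0 → A / A g → A / A g h → A / A h → 0`; it
is injective because `h` can be cancelled on the right. -/
theorem length_cyclicModule_mul [IsDomain A] (g : A) {h : A} (hh : h ≠ 0) :
    Module.length A (CyclicModule (g * h)) =
      Module.length A (CyclicModule g) + Module.length A (CyclicModule h) := by
  have hle : Ideal.span {g * h} ≤ Ideal.span {h} := by
    rw [Ideal.span_le, Set.singleton_subset_iff]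
    exact Ideal.mul_mem_left _ _ (Ideal.mem_span_singleton_self h)
  have hmem (a : A) (ha : a ∈ Ideal.span {g}) :
      LinearMap.toSpanSingleton A A h a ∈ Ideal.span {g * h} := by
    obtain ⟨u, rfl⟩ := Ideal.mem_span_singleton'.1 ha
    exact Ideal.mem_span_singleton'.2 ⟨u, (mul_assoc _ _ _).symm⟩
  let i : CyclicModule g →ₗ[A] CyclicModule (g * h) :=
    Submodule.mapQ _ _ (LinearMap.toSpanSingleton A A h) hmem
  let p : CyclicModule (g * h) →ₗ[A] CyclicModule h := Submodule.factor hle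
  refine Module.length_eq_add_of_exact i p ?_ (Submodule.factor_surjective hle) ?_
  · rw [← LinearMap.ker_eq_bot, LinearMap.ker_eq_bot']
    intro v hv
    obtain ⟨v, rfl⟩ := Submodule.Quotient.mk_surjective _ v
    have hv : v * h ∈ Ideal.span {g * h} := (Submodule.Quotient.mk_eq_zero _).1 hv
    obtain ⟨u, hu⟩ := Ideal.mem_span_singleton'.1 hv
    rw [← mul_assoc] at hu
    rw [Submodule.Quotient.mk_eq_zero]
    exact Ideal.mem_span_singleton'.2 ⟨u, mul_right_cancel₀ hh hu⟩
  · intro v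
    obtain ⟨v, rfl⟩ := Submodule.Quotient.mk_surjective _ v
    constructor
    · intro hv
      have hv : v ∈ Ideal.span {h} := (Submodule.Quotient.mk_eq_zero _).1 hv
      obtain ⟨u, rfl⟩ := Ideal.mem_span_singleton'.1 hv
      exact ⟨Submodule.Quotient.mk u, rfl⟩
    · rintro ⟨u, hu⟩
      obtain ⟨u, rfl⟩ := Submodule.Quotient.mk_surjective _ u
      rw [← hu]
      refine (Submodule.Quotient.mk_eq_zero _).2 ?_
      exact Ideal.mem_span_singleton'.2 ⟨u, rfl⟩

theorem length_cyclicModule_prod [IsDomain A] (l : List A)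
    (hl : ∀ g ∈ l, g ≠ 0 ∧ IsSimpleModule A (CyclicModule g)) :
    Module.length A (CyclicModule l.prod) = l.length := by
  induction l with
  | nil =>
    rw [List.prod_nil, List.length_nil, Nat.cast_zero, Module.length_eq_zero_iff,
      Submodule.Quotient.subsingleton_iff]
    exact Ideal.span_singleton_one
  | cons g l ih =>
    have h0 : l.prod ≠ 0 := by
      rw [Ne, List.prod_eq_zero_iff]
      exact fun h => (hl 0 (List.mem_cons_of_mem _ h)).1 rfl
    have := (hl g List.mem_cons_self).2
    rw [List.prod_cons, length_cyclicModule_mul _ h0,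
      ih fun g hg => hl g (List.mem_cons_of_mem _ hg), Module.length_eq_one, List.length_cons,
      Nat.cast_add, Nat.cast_one, add_comm]

variable (K : Type*) [CommRing K] [Algebra K A] (f : A)

theorem eigenringHom_injective : Function.Injective (eigenringHom K f) := by
  rw [injective_iff_map_eq_zero]
  intro d hd
  obtain ⟨g, rfl⟩ := Ideal.Quotient.mk_surjective d
  have h := congrArg (fun φ => φ.unop (Submodule.Quotient.mk 1)) hd
  have h : (Submodule.Quotient.mk (1 * (g : A)) : CyclicModule f) = 0 := h
  rw [one_mul, Submodule.Quotient.mk_eq_zero] at h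
  exact Ideal.Quotient.eq_zero_iff_mem.2 ((mem_idealiserIdeal K f g).2 h)

/-- An endomorphism is determined by the image of the class of `1`. Since `f` kills that class, it
kills the image, which says that a representative of the image lies in the idealiser. -/
theorem eigenringHom_surjective : Function.Surjective (eigenringHom K f) := by
  intro φ
  obtain ⟨g, hg⟩ := Submodule.Quotient.mk_surjective _ (φ.unop (Submodule.Quotient.mk 1))
  have hmem : g ∈ idealiser K f := by
    change f * g ∈ Ideal.span {f}
    rw [← Submodule.Quotient.mk_eq_zero]
    change f • (Submodule.Quotient.mk g : CyclicModule f) = _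
    rw [hg, ← map_smul]
    convert map_zero φ.unop
    change (Submodule.Quotient.mk (f * 1) : CyclicModule f) = _
    rw [mul_one, Submodule.Quotient.mk_eq_zero]
    exact Ideal.mem_span_singleton_self f
  refine ⟨Ideal.Quotient.mk _ ⟨g, hmem⟩, MulOpposite.unop_injective (LinearMap.ext fun v => ?_)⟩
  obtain ⟨v, rfl⟩ := Submodule.Quotient.mk_surjective _ v
  change v • (Submodule.Quotient.mk g : CyclicModule f) = _
  rw [hg, ← map_smul]
  change φ.unop (Submodule.Quotient.mk (v * 1)) = _
  rw [mul_one]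

theorem eigenring_smul_eq (d : Eigenring K f) (v : CyclicModule f) :
    MulOpposite.op d • v = (eigenringHom K f d).unop v := rfl

variable {f} in
theorem eigenring_isUnit [IsSimpleModule A (CyclicModule f)] (d : Eigenring K f) (hd : d ≠ 0) :
    IsUnit d := by
  classical
  let e := RingEquiv.ofBijective _ ⟨eigenringHom_injective K f, eigenringHom_surjective K f⟩
  have h0 : e d ≠ 0 := by simpa using hd
  have : IsUnit (e d) := by
    have hu : IsUnit (e d).unop := by
      refine isUnit_iff_ne_zero.2 ?_
      simpa using h0
    simpa using hu.op
  simpa using this.map e.symm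

variable {f} in
theorem eigenring_nontrivial [IsSimpleModule A (CyclicModule f)] : Nontrivial (Eigenring K f) := by
  have : Nontrivial (CyclicModule f) := IsSimpleModule.nontrivial A _
  exact (RingEquiv.ofBijective _ ⟨eigenringHom_injective K f, eigenringHom_surjective K f⟩).toEquiv.nontrivial

instance eigenring_isScalarTower : IsScalarTower K (Eigenring K f)ᵐᵒᵖ (CyclicModule f) where
  smul_assoc c d v := by
    obtain ⟨d, rfl⟩ := MulOpposite.op_surjective d
    obtain ⟨g, rfl⟩ := Ideal.Quotient.mk_surjective d
    obtain ⟨v, rfl⟩ := Submodule.Quotient.mk_surjective _ v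
    change Submodule.Quotient.mk (v * ((c • g : idealiser K f) : A)) =
      Submodule.Quotient.mk (c • (v * (g : A)))
    rw [Subalgebra.coe_smul, mul_smul_comm]

theorem smul_eigenring_smul (a : A) (d : (Eigenring K f)ᵐᵒᵖ) (v : CyclicModule f) :
    a • d • v = d • a • v := by
  obtain ⟨d, rfl⟩ := MulOpposite.op_surjective d
  rw [eigenring_smul_eq, eigenring_smul_eq, map_smul]

/-- `d ↦ 1 · d` as a linear map from the eigenring to `A / A f`. -/
def eigenringToCyclic : Eigenring K f →ₗ[K] CyclicModule f :=
  (LinearMap.toSpanSingleton (Eigenring K f)ᵐᵒᵖ (CyclicModule f)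
    (Submodule.Quotient.mk 1)).restrictScalars K ∘ₗ (MulOpposite.opLinearEquiv K).toLinearMap

theorem eigenringToCyclic_injective : Function.Injective (eigenringToCyclic K f) := by
  rw [injective_iff_map_eq_zero]
  intro d hd
  obtain ⟨g, rfl⟩ := Ideal.Quotient.mk_surjective d
  have h : (Submodule.Quotient.mk (1 * (g : A)) : CyclicModule f) = 0 := hd
  rw [one_mul, Submodule.Quotient.mk_eq_zero] at h
  exact Ideal.Quotient.eq_zero_iff_mem.2 ((mem_idealiserIdeal K f g).2 h)

/-- Every `A`-endomorphism is a right multiplication by the eigenring, so a map linear over the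
eigenring is linear over `End_A(A / A f)`. Jacobson density then realises it on the finite basis by
an element of `A`. -/
theorem exists_smul_basis_eq [IsSimpleModule A (CyclicModule f)] {ι : Type*} [Fintype ι]
    (b : Module.Basis ι (Eigenring K f)ᵐᵒᵖ (CyclicModule f)) (w : ι → CyclicModule f) :
    ∃ a : A, ∀ i, a • b i = w i := by
  classical
  let φ : Module.End (Module.End A (CyclicModule f)) (CyclicModule f) :=
    { b.constr ℕ w with
      map_smul' := by
        intro e v
        obtain ⟨d, hd⟩ := eigenringHom_surjective K f (MulOpposite.op e)
        have he (v : CyclicModule f) : e • v = MulOpposite.op d • v := by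
          rw [eigenring_smul_eq, hd]; rfl
        change b.constr ℕ w (e • v) = e • b.constr ℕ w v
        rw [he, he, map_smul] }
  obtain ⟨a, ha⟩ := jacobson_density φ (Finset.univ.image b)
  refine ⟨a, fun i => ?_⟩
  rw [← ha _ (Finset.mem_image_of_mem b (Finset.mem_univ i))]
  exact b.constr_basis ℕ w i

theorem smul_eq_zero_of_basis {ι : Type*} [Fintype ι]
    (b : Module.Basis ι (Eigenring K f)ᵐᵒᵖ (CyclicModule f)) {a : A} (h : ∀ i, a • b i = 0)
    (v : CyclicModule f) : a • v = 0 := by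
  rw [← b.sum_repr v, Finset.smul_sum]
  refine Finset.sum_eq_zero fun i _ => ?_
  rw [smul_eigenring_smul, h, smul_zero]

variable {K f} in
/-- The matrix of the left multiplication by `a` on `A / A f` with respect to a basis over the
eigenring. -/
def basisMatrix {ι : Type*} [Fintype ι] [DecidableEq ι]
    (b : Module.Basis ι (Eigenring K f)ᵐᵒᵖ (CyclicModule f)) :
    A →ₐ[K] Matrix ι ι (Eigenring K f) :=
  AlgHom.ofLinearMap
    { toFun := fun a => Matrix.of fun i j => (b.repr (a • b j) i).unop
      map_add' := fun a a' => by ext i j; simp [add_smul]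
      map_smul' := fun c a => by
        ext i j
        have : (c • a) • b j = (c • (1 : (Eigenring K f)ᵐᵒᵖ)) • a • b j := by
          rw [smul_assoc, smul_assoc, one_smul]
        change (b.repr ((c • a) • b j) i).unop = c • (b.repr (a • b j) i).unop
        rw [this, map_smul, Finsupp.smul_apply, smul_eq_mul, smul_mul_assoc, one_mul,
          MulOpposite.unop_smul] }
    (by
      ext i j
      simp [Matrix.one_apply, Finsupp.single_apply, eq_comm, apply_ite MulOpposite.unop])
    (by
      intro a a'
      ext i j
      have h : (a * a') • b j = ∑ k, b.repr (a' • b j) k • a • b k := by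
        conv_lhs => rw [mul_smul, ← b.sum_repr (a' • b j), Finset.smul_sum]
        exact Finset.sum_congr rfl fun k _ => smul_eigenring_smul K f _ _ _
      simp [h, Matrix.mul_apply, Finsupp.finsetSum_apply])

variable {K f} in
theorem smul_basis_eq {ι : Type*} [Fintype ι] [DecidableEq ι]
    (b : Module.Basis ι (Eigenring K f)ᵐᵒᵖ (CyclicModule f)) (a : A) (j : ι) :
    a • b j = ∑ i, MulOpposite.op (basisMatrix b a i j) • b i :=
  (b.sum_repr (a • b j)).symm

variable {K f} in
theorem basisMatrix_surjective [IsSimpleModule A (CyclicModule f)] {ι : Type*} [Fintype ι]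
    [DecidableEq ι] (b : Module.Basis ι (Eigenring K f)ᵐᵒᵖ (CyclicModule f)) :
    Function.Surjective (basisMatrix b) := by
  intro M
  obtain ⟨a, ha⟩ := exists_smul_basis_eq K f b fun j => ∑ i, MulOpposite.op (M i j) • b i
  refine ⟨a, ?_⟩
  ext i j
  change (b.repr (a • b j) i).unop = _
  rw [ha, b.repr_sum_self, MulOpposite.unop_op]

variable {K f} in
theorem basisMatrix_eq_zero {ι : Type*} [Fintype ι] [DecidableEq ι]
    (b : Module.Basis ι (Eigenring K f)ᵐᵒᵖ (CyclicModule f)) {a : A} :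
    basisMatrix b a = 0 ↔ a ∈ Module.annihilator A (CyclicModule f) := by
  rw [Module.mem_annihilator]
  constructor
  · intro h
    refine smul_eq_zero_of_basis K f b fun j => ?_
    simp [smul_basis_eq, h]
  · intro h
    ext i j
    change (b.repr (a • b j) i).unop = _
    simp [h]

end Cyclic

namespace SkewPoly

/-! ### Left ideals, irreducible elements and two-sided ideals of `L[x; σ]` -/

section Ideals

variable {K L : Type*} [Field K] [Field L] [Algebra K L] {σ : L ≃ₐ[K] L}

theorem exists_monic_generator {I : Ideal (SkewPoly σ)} (hI : I ≠ ⊥) :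
    ∃ h ∈ I, ∃ d, HasDeg h d ∧ cf d h = 1 ∧ (∀ g ∈ I, g ∈ degLT σ d → g = 0) ∧
      I = Ideal.span {h} := by
  classical
  have hex : ∃ d, ∃ g ∈ I, HasDeg g d := by
    obtain ⟨g, hg, h0⟩ := Submodule.exists_mem_ne_zero_of_ne_bot hI
    obtain ⟨d, hd⟩ := exists_hasDeg h0
    exact ⟨d, g, hg, hd⟩
  obtain ⟨g, hg, hd⟩ := Nat.find_spec hex
  set d := Nat.find hex with hdef
  have hmin : ∀ g ∈ I, g ∈ degLT σ d → g = 0 := by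
    intro g hg hgd
    by_contra h0
    obtain ⟨e, he, hge⟩ := exists_hasDeg_lt hgd h0
    exact Nat.find_min hex he ⟨g, hg, hge⟩
  have hc : (cf d g)⁻¹ ≠ 0 := inv_ne_zero hd.1
  have hdeg : HasDeg (mono σ 0 (cf d g)⁻¹ * g) d := by
    simpa using (hasDeg_mono (σ := σ) (i := 0) hc).mul hd
  refine ⟨_, Ideal.mul_mem_left I (mono σ 0 (cf d g)⁻¹) hg, d, hdeg, ?_, hmin, ?_⟩
  · have := cf_add_mul (mono_mem_degLT (σ := σ) (zero_lt_one' ℕ) (cf d g)⁻¹) hd.2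
    rw [zero_add] at this
    rw [this]
    simp [hd.1]
  · refine le_antisymm (fun u hu => ?_) ?_
    · obtain ⟨q, hq⟩ := exists_sub_mul_mem_degLT hdeg u
      have := hmin _ (I.sub_mem hu (Ideal.mul_mem_left _ q (Ideal.mul_mem_left _ _ hg))) hq
      exact Ideal.mem_span_singleton'.2 ⟨q, (sub_eq_zero.1 this).symm⟩
    · rw [Ideal.span_le, Set.singleton_subset_iff]
      exact Ideal.mul_mem_left _ _ hg

/-- All left ideals are principal, so a left ideal strictly above `R g` comes from a right divisor
of `g` that is not associated to `g`, and this divisor is a unit. -/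
theorem isSimpleModule_of_irreducible {g : SkewPoly σ} (hg : Irreducible g) :
    IsSimpleModule (SkewPoly σ) (CyclicModule g) := by
  rw [isSimpleModule_iff_isCoatom]
  constructor
  · intro h
    obtain ⟨a, ha⟩ := Ideal.mem_span_singleton'.1 ((Ideal.eq_top_iff_one _).1 h)
    refine hg.1 ⟨⟨g, a, ?_, ha⟩, rfl⟩
    apply mul_right_cancel₀ hg.ne_zero
    rw [mul_assoc, ha, mul_one, one_mul]
  · intro I hI
    obtain ⟨h, hhI, -, -, -, -, rfl⟩ := exists_monic_generator (bot_le.trans_lt hI).ne'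
    obtain ⟨a, ha⟩ := Ideal.mem_span_singleton'.1 (hI.le (Ideal.mem_span_singleton_self g))
    rcases hg.isUnit_or_isUnit ha.symm with hu | hu
    · refine absurd ?_ hI.not_ge
      rw [Ideal.span_le, Set.singleton_subset_iff]
      obtain ⟨u, rfl⟩ := hu
      refine Ideal.mem_span_singleton'.2 ⟨((u⁻¹ : (SkewPoly σ)ˣ) : SkewPoly σ), ?_⟩
      rw [← ha, Units.inv_mul_cancel_left]
    · exact Ideal.eq_top_of_isUnit_mem _ hhI hu

theorem hasDeg_zero_isUnit {g : SkewPoly σ} (hg : HasDeg g 0) : IsUnit g := by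
  have h : g = mono σ 0 (cf 0 g) := by
    conv_lhs => rw [eq_sum_mono hg.2]
    simp
  refine ⟨⟨g, mono σ 0 (cf 0 g)⁻¹, ?_, ?_⟩, rfl⟩
  · rw [h, mono_mul_mono]; simp [hg.1, mono_zero_one]
  · rw [h, mono_mul_mono]; simp [hg.1, mono_zero_one]

theorem isUnit_iff_hasDeg {g : SkewPoly σ} : IsUnit g ↔ HasDeg g 0 := by
  refine ⟨fun h => ?_, hasDeg_zero_isUnit⟩
  obtain ⟨u, rfl⟩ := h
  obtain ⟨d, hd⟩ := exists_hasDeg u.ne_zero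
  obtain ⟨e, he⟩ := exists_hasDeg (u⁻¹).ne_zero
  have h1 := hd.mul he
  rw [Units.mul_inv, ← mono_zero_one] at h1
  have := h1.unique (hasDeg_mono one_ne_zero)
  obtain rfl : d = 0 := by omega
  exact hd

theorem irreducible_of_hasDeg_one {g : SkewPoly σ} (hg : HasDeg g 1) : Irreducible g := by
  refine ⟨fun h => ?_, fun a b hab => ?_⟩
  · exact absurd (hg.unique (isUnit_iff_hasDeg.1 h)) one_ne_zero
  · have h0 := hg.ne_zero
    rw [hab] at h0
    obtain ⟨d, hd⟩ := exists_hasDeg (left_ne_zero_of_mul h0)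
    obtain ⟨e, he⟩ := exists_hasDeg (right_ne_zero_of_mul h0)
    have := (hd.mul he).unique (hab ▸ hg)
    rcases Nat.eq_zero_or_pos d with rfl | h
    · exact Or.inl (isUnit_iff_hasDeg.2 hd)
    · obtain rfl : e = 0 := by omega
      exact Or.inr (isUnit_iff_hasDeg.2 he)

theorem exists_isProductOfIrreducibles {g : SkewPoly σ} (h0 : g ≠ 0) (hu : ¬ IsUnit g) :
    ∃ m, IsProductOfIrreducibles g m := by
  obtain ⟨d, hd⟩ := exists_hasDeg h0
  induction d using Nat.strong_induction_on generalizing g with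
  | _ d ih =>
    by_cases hirr : Irreducible g
    · exact ⟨1, [g], by simp [hirr]⟩
    obtain ⟨a, b, ha, hb, rfl⟩ : ∃ a b, ¬ IsUnit a ∧ ¬ IsUnit b ∧ g = a * b := by
      by_contra! H
      refine hirr ⟨hu, fun a b hab => ?_⟩
      by_contra! h
      exact H a b h.1 h.2 hab
    obtain ⟨i, hi⟩ := exists_hasDeg (left_ne_zero_of_mul h0)
    obtain ⟨j, hj⟩ := exists_hasDeg (right_ne_zero_of_mul h0)
    have hij := (hi.mul hj).unique hd
    have hi0 : i ≠ 0 := by rintro rfl; exact ha (isUnit_iff_hasDeg.2 hi)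
    have hj0 : j ≠ 0 := by rintro rfl; exact hb (isUnit_iff_hasDeg.2 hj)
    obtain ⟨p, l, rfl, hl, hlp⟩ := ih i (by omega) (left_ne_zero_of_mul h0) ha hi
    obtain ⟨q, l', rfl, hl', hlq⟩ := ih j (by omega) (right_ne_zero_of_mul h0) hb hj
    refine ⟨_, l ++ l', rfl, fun g hg => ?_, by rw [List.prod_append, hlp, hlq]⟩
    rcases List.mem_append.1 hg with h | h
    · exact hl g h
    · exact hl' g h

theorem length_eq_of_isProductOfIrreducibles {g : SkewPoly σ} {m : ℕ}
    (h : IsProductOfIrreducibles g m) : Module.length (SkewPoly σ) (CyclicModule g) = m := by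
  obtain ⟨l, rfl, hl, rfl⟩ := h
  exact length_cyclicModule_prod l fun g hg =>
    ⟨(hl g hg).ne_zero, isSimpleModule_of_irreducible (hl g hg)⟩

theorem central_injective [FiniteDimensional K L] :
    Function.Injective (central σ : Polynomial K → SkewPoly σ) := by
  intro F G h
  ext i
  apply (algebraMap K L).injective
  rw [← cf_central (σ := σ), h, cf_central]

theorem central_mul (F G : Polynomial K) : central σ (F * G) = central σ F * central σ G :=
  map_mul _ _ _

theorem central_add (F G : Polynomial K) : central σ (F + G) = central σ F + central σ G :=
  map_add _ _ _

theorem orderOf_eq_finrank [FiniteDimensional K L] [IsGalois K L]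
    (hσ : ∀ τ : L ≃ₐ[K] L, τ ∈ Subgroup.zpowers σ) : orderOf σ = Module.finrank K L := by
  rw [orderOf_eq_card_of_forall_mem_zpowers hσ, IsGalois.card_aut_eq_finrank]

theorem mem_range_of_fixed [FiniteDimensional K L] [IsGalois K L]
    (hσ : ∀ τ : L ≃ₐ[K] L, τ ∈ Subgroup.zpowers σ) {a : L} (ha : σ a = a) :
    ∃ c, algebraMap K L c = a := by
  refine (IsGalois.mem_range_algebraMap_iff_fixed a).2 fun τ => ?_
  have : Subgroup.zpowers σ ≤ MulAction.stabilizer (L ≃ₐ[K] L) a := by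
    rw [Subgroup.zpowers_le]
    exact ha
  exact this (hσ τ)

/-- The elements `h a - σ ^ d(a) h` and `x h - h x` lie in the ideal and have degree less than `d`,
so they vanish. The first shows that only exponents `i` with `σ ^ i = σ ^ d` occur, the second that
the coefficients are fixed by `σ`. A nonzero constant coefficient turns the condition on exponents
into `n ∣ i`. -/
theorem eq_central_of_twoSided [FiniteDimensional K L] [IsGalois K L]
    (hσ : ∀ τ : L ≃ₐ[K] L, τ ∈ Subgroup.zpowers σ) {I : Ideal (SkewPoly σ)} [I.IsTwoSided]
    {h : SkewPoly σ} {d : ℕ} (hI : h ∈ I) (hd : HasDeg h d) (h1 : cf d h = 1)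
    (hmin : ∀ g ∈ I, g ∈ degLT σ d → g = 0) (h0 : cf 0 h ≠ 0) : ∃ G, central σ G = h := by
  have hpow : ∀ i, cf i h ≠ 0 → σ ^ i = σ ^ d := by
    intro i hi
    ext a
    have hu : h * mono σ 0 a - mono σ 0 ((σ ^ d) a) * h = 0 := by
      refine hmin _ (I.sub_mem (I.mul_mem_right _ hI) (I.mul_mem_left _ hI))
        (mem_degLT_of_succ (Submodule.sub_mem _ ?_ ?_) ?_)
      · exact mul_mem_degLT (e := 0) hd.2 (mono_mem_degLT zero_lt_one a)
      · simpa using mul_mem_degLT (d := 0) (mono_mem_degLT (σ := σ) zero_lt_one ((σ ^ d) a)) hd.2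
      · have e1 := cf_add_mul hd.2 (mono_mem_degLT (σ := σ) (zero_lt_one' ℕ) a)
        have e2 := cf_add_mul (mono_mem_degLT (σ := σ) (zero_lt_one' ℕ) ((σ ^ d) a)) hd.2
        rw [add_zero] at e1
        rw [zero_add] at e2
        rw [map_sub, e1, e2]
        simp [h1]
    have := congrArg (cf i) hu
    rw [map_sub, map_zero, sub_eq_zero, cf_mul, cf_mul, Finset.sum_eq_single (i, 0),
      Finset.sum_eq_single (0, i)] at this
    · simp only [cf_mono_self, pow_zero, AlgEquiv.one_apply] at this
      rw [mul_comm] at this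
      exact mul_right_cancel₀ hi this
    · rintro ⟨p, q⟩ hp hne
      rw [Finset.HasAntidiagonal.mem_antidiagonal] at hp
      rw [cf_mono_ne, zero_mul]
      rintro rfl
      exact hne (by ext <;> simp_all)
    · intro hp
      exact absurd (by simp [Finset.HasAntidiagonal.mem_antidiagonal]) hp
    · rintro ⟨p, q⟩ hp hne
      rw [Finset.HasAntidiagonal.mem_antidiagonal] at hp
      rw [cf_mono_ne, map_zero, mul_zero]
      rintro rfl
      exact hne (by ext <;> simp_all)
    · intro hp
      exact absurd (by simp [Finset.HasAntidiagonal.mem_antidiagonal]) hp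
  have cfX (i : ℕ) (g : SkewPoly σ) : cf (i + 1) (mono σ 1 1 * g) = σ (cf i g) := by
    rw [cf_mul, Finset.sum_eq_single (1, i)]
    · simp
    · rintro ⟨p, q⟩ hp hne
      rw [Finset.HasAntidiagonal.mem_antidiagonal] at hp
      rw [cf_mono_ne, zero_mul]
      rintro rfl
      exact hne (by ext <;> simp only at hp ⊢; omega)
    · intro hp
      exact absurd (by simp [Finset.HasAntidiagonal.mem_antidiagonal, add_comm]) hp
  have cfX' (i : ℕ) (g : SkewPoly σ) : cf (i + 1) (g * mono σ 1 1) = cf i g := by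
    rw [cf_mul, Finset.sum_eq_single (i, 1)]
    · simp
    · rintro ⟨p, q⟩ hp hne
      rw [Finset.HasAntidiagonal.mem_antidiagonal] at hp
      rw [cf_mono_ne, map_zero, mul_zero]
      rintro rfl
      exact hne (by ext <;> simp only at hp ⊢; omega)
    · intro hp
      exact absurd (by simp [Finset.HasAntidiagonal.mem_antidiagonal]) hp
  have hfix : ∀ i, σ (cf i h) = cf i h := by
    intro i
    have hu : mono σ 1 1 * h - h * mono σ 1 1 = 0 := by
      refine hmin _ (I.sub_mem (I.mul_mem_left _ hI) (I.mul_mem_right _ hI))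
        (mem_degLT_of_succ (mem_degLT_of_succ (Submodule.sub_mem _ ?_ ?_) ?_) ?_)
      · simpa [add_comm] using
          mul_mem_degLT (d := 1) (mono_mem_degLT (σ := σ) one_lt_two (1 : L)) hd.2
      · exact mul_mem_degLT (e := 1) hd.2 (mono_mem_degLT one_lt_two (1 : L))
      · rw [map_sub, cfX, cfX', h1, map_one, sub_self]
      -- The coefficient of `x ^ d` in `x h - h x` is `σ(c) - c`, where `c` is the coefficient of
      -- `h` just below the leading one. If `c ≠ 0`, two consecutive powers of `σ` agree, so `σ =
      -- 1`.
      · rcases d with _ | d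
        · rw [map_sub, cf_mul, cf_mul]
          simp [cf_mono_ne]
        · rw [map_sub, cfX, cfX']
          by_cases hc : cf d h = 0
          · simp [hc]
          · have := hpow d hc
            rw [pow_succ, left_eq_mul] at this
            simp [this]
    have := congrArg (cf (i + 1)) hu
    rwa [map_sub, map_zero, sub_eq_zero, cfX, cfX'] at this
  choose c hc using fun i => mem_range_of_fixed hσ (hfix i)
  set n := Module.finrank K L
  have hn : 0 < n := Module.finrank_pos
  have hdvd : ∀ i, cf i h ≠ 0 → n ∣ i := by
    intro i hi
    rw [show n = orderOf σ from (orderOf_eq_finrank hσ).symm]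
    refine orderOf_dvd_of_pow_eq_one ?_
    rw [hpow i hi, ← hpow 0 h0, pow_zero]
  refine ⟨∑ j ∈ Finset.range (d + 1), Polynomial.monomial j (c (j * n)), ext_cf fun i => ?_⟩
  by_cases hi : n ∣ i
  · obtain ⟨j, rfl⟩ := hi
    rw [mul_comm n j, cf_central, Polynomial.finsetSum_coeff]
    simp_rw [Polynomial.coeff_monomial]
    rw [Finset.sum_ite_eq', ← hc]
    split_ifs with hj
    · rfl
    · rw [map_zero, hc, hd.2]
      have : j * 1 ≤ j * n := Nat.mul_le_mul_left j hn
      simp at hj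
      omega
  · rw [cf_central_of_not_dvd _ hi]
    by_contra hne
    exact hi (hdvd i (Ne.symm hne))

theorem eq_span_central_of_twoSided [FiniteDimensional K L] [IsGalois K L]
    (hσ : ∀ τ : L ≃ₐ[K] L, τ ∈ Subgroup.zpowers σ) {F : Polynomial K} (hF : Irreducible F)
    (hF0 : F.coeff 0 ≠ 0) {I : Ideal (SkewPoly σ)} [I.IsTwoSided] (hFI : central σ F ∈ I)
    (hI : I ≠ ⊤) : I = Ideal.span {central σ F} := by
  refine le_antisymm ?_ (by rwa [Ideal.span_le, Set.singleton_subset_iff])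
  have hbot : I ≠ ⊥ := by
    rintro rfl
    exact (hasDeg_central hF.ne_zero).ne_zero hFI
  obtain ⟨h, hhI, d, hd, h1, hmin, hspan⟩ := exists_monic_generator hbot
  have h0 : cf 0 h ≠ 0 := by
    obtain ⟨u, hu⟩ := Ideal.mem_span_singleton'.1 (hspan ▸ hFI)
    intro h0
    have := cf_central (σ := σ) F 0
    rw [zero_mul, ← hu, cf_mul] at this
    simp [h0] at this
    exact hF0 ((map_eq_zero _).1 this.symm)
  obtain ⟨G, rfl⟩ := eq_central_of_twoSided hσ hhI hd h1 hmin h0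
  have hG0 : G ≠ 0 := by
    rintro rfl
    exact hd.ne_zero (map_zero _)
  have hn : 0 < Module.finrank K L := Module.finrank_pos
  have hdG := hd.unique (hasDeg_central hG0)
  have hGF : G ∣ F := by
    rw [← EuclideanDomain.mod_eq_zero]
    -- The remainder of `F` modulo `G` gives an element of `I` of degree below that of `h`, hence
    -- zero.
    have hmem : central σ (F % G) ∈ I := by
      have : central σ F = central σ (F / G) * central σ G + central σ (F % G) := by
        rw [← central_mul, ← central_add, mul_comm, EuclideanDomain.div_add_mod]
      rw [eq_comm, ← eq_sub_iff_add_eq'] at this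
      rw [this]
      exact I.sub_mem hFI (I.mul_mem_left _ hhI)
    by_contra hne
    refine hne (central_injective (σ := σ) ?_)
    have h0 : central σ (0 : Polynomial K) = 0 := map_zero _
    rw [h0]
    refine hmin _ hmem ?_
    refine degLT_mono ?_ (central_mem_degLT _)
    have := Polynomial.natDegree_lt_natDegree hne (EuclideanDomain.mod_lt F hG0)
    rw [hdG]
    calc _ ≤ (F % G).natDegree * Module.finrank K L + Module.finrank K L := by omega
      _ = ((F % G).natDegree + 1) * Module.finrank K L := by ring
      _ ≤ _ := Nat.mul_le_mul_right _ this
  obtain ⟨H, hH⟩ := hGF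
  rcases hF.isUnit_or_isUnit hH with hu | hu
  · refine absurd (Ideal.eq_top_of_isUnit_mem _ hhI ?_) hI
    exact hu.map (Polynomial.aeval (mono σ (Module.finrank K L) (1 : L)))
  · obtain ⟨u, rfl⟩ := hu
    rw [hspan, Ideal.span_le, Set.singleton_subset_iff]
    refine Ideal.mem_span_singleton'.2 ⟨central σ (u⁻¹ : (Polynomial K)ˣ), ?_⟩
    rw [← central_mul, hH, mul_comm G, Units.inv_mul_cancel_left]

end Ideals

end SkewPoly


/-! ### Dimensions over `K` and polynomial roots in algebras -/

section Finrank

variable {K : Type*} [Field K] {D : Type*} [Ring D] [Algebra K D]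

theorem finrank_eq_of_basis_op {V : Type*} [AddCommGroup V] [Module K V]
    [Module Dᵐᵒᵖ V] [IsScalarTower K Dᵐᵒᵖ V] {m : ℕ} (b : Module.Basis (Fin m) Dᵐᵒᵖ V)
    [Module.Finite K D] : Module.finrank K V = m * Module.finrank K D := by
  have e := b.equivFun.restrictScalars K
  rw [e.finrank_eq, Module.finrank_pi_fintype]
  simp [(MulOpposite.opLinearEquiv K (M := D)).finrank_eq]

/-- The root makes `D` a vector space over the field `K[y] / (F)`, and the tower law applies. -/
theorem natDegree_dvd_finrank_of_aeval_eq_zero {F : Polynomial K} (hF : Irreducible F) {y : D}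
    (hy : Polynomial.aeval y F = 0) : F.natDegree ∣ Module.finrank K D := by
  have : Fact (Irreducible F) := ⟨hF⟩
  let φ : AdjoinRoot F →ₐ[K] D :=
    Ideal.Quotient.liftₐ (Ideal.span {F}) (Polynomial.aeval y) (by
        intro a ha
        obtain ⟨u, rfl⟩ := Ideal.mem_span_singleton'.1 ha
        rw [map_mul, hy, mul_zero])
  let : Module (AdjoinRoot F) D := Module.compHom _ φ.toRingHom
  have : IsScalarTower K (AdjoinRoot F) D := ⟨fun c e d => by
    change φ (c • e) * d = c • (φ e * d)
    rw [map_smul, smul_mul_assoc]⟩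
  refine ⟨Module.finrank (AdjoinRoot F) D, ?_⟩
  rw [← Module.finrank_mul_finrank K (AdjoinRoot F) D,
    (AdjoinRoot.powerBasis hF.ne_zero).finrank, AdjoinRoot.powerBasis_dim]

theorem coeff_zero_ne_zero_of_irreducible {F : Polynomial K} (hm : F.Monic) (hF : Irreducible F)
    (hX : F ≠ Polynomial.X) : F.coeff 0 ≠ 0 := by
  intro h0
  have := (Polynomial.prime_X.irreducible.associated_of_dvd hF (Polynomial.X_dvd_iff.2 h0))
  exact hX (Polynomial.eq_of_monic_of_associated hm Polynomial.monic_X this.symm)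

end Finrank

namespace SkewPoly

/-! ### The structure of `R / R F(x ^ n)` as a matrix ring over the eigenring -/

section Structure

variable {K L : Type*} [Field K] [Field L] [Algebra K L] [FiniteDimensional K L] {σ : L ≃ₐ[K] L}

theorem finrank_quot {F : Polynomial K} (hF : F ≠ 0) :
    Module.Finite K (Quot σ F) ∧ Module.finrank K (Quot σ F) =
      Module.finrank K L * (F.natDegree * Module.finrank K L) :=
  finrank_cyclicModule (hasDeg_central hF)

theorem finite_cyclicModule {f : SkewPoly σ} (hf : f ≠ 0) : Module.Finite K (CyclicModule f) := by
  obtain ⟨d, hd⟩ := exists_hasDeg hf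
  exact (finrank_cyclicModule hd).1

theorem finite_eigenring {f : SkewPoly σ} (hf : f ≠ 0) : Module.Finite K (Eigenring K f) :=
  have := finite_cyclicModule hf
  Module.Finite.of_injective _ (eigenringToCyclic_injective K f)

theorem exists_basis {f : SkewPoly σ} (hf : Irreducible f) :
    ∃ m, Nonempty (Module.Basis (Fin m) (Eigenring K f)ᵐᵒᵖ (CyclicModule f)) := by
  have := isSimpleModule_of_irreducible hf
  have := eigenring_nontrivial (f := f) K
  have := finite_cyclicModule hf.ne_zero
  have : Module.Finite (Eigenring K f)ᵐᵒᵖ (CyclicModule f) :=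
    Module.Finite.of_restrictScalars_finite K _ _
  have hu := forall_isUnit_op (eigenring_isUnit (f := f) K)
  have := free_of_forall_isUnit hu (V := CyclicModule f)
  have := strongRankCondition_of_forall_isUnit hu
  exact ⟨_, ⟨Module.finBasis _ _⟩⟩

theorem finrank_cyclicModule_eq {f : SkewPoly σ} (hf : Irreducible f) {m : ℕ}
    (b : Module.Basis (Fin m) (Eigenring K f)ᵐᵒᵖ (CyclicModule f)) :
    Module.finrank K (CyclicModule f) = m * Module.finrank K (Eigenring K f) := by
  have := finite_eigenring hf.ne_zero
  exact finrank_eq_of_basis_op b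

variable [IsGalois K L]

/-- The annihilator is a proper two-sided ideal, and it contains `F(x ^ n)` because this element is
central and lies in `R f`. -/
theorem annihilator_cyclicModule (hσ : ∀ τ : L ≃ₐ[K] L, τ ∈ Subgroup.zpowers σ)
    {F : Polynomial K} (hF : Irreducible F) (hF0 : F.coeff 0 ≠ 0) {f g : SkewPoly σ}
    (hf : Irreducible f) (hg : central σ F = g * f) :
    Module.annihilator (SkewPoly σ) (CyclicModule f) = Ideal.span {central σ F} := by
  have := isSimpleModule_of_irreducible hf
  have : Nontrivial (CyclicModule f) := IsSimpleModule.nontrivial (SkewPoly σ) _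
  refine eq_span_central_of_twoSided hσ hF hF0 ?_ ?_
  · rw [Module.mem_annihilator]
    intro v
    obtain ⟨v, rfl⟩ := Submodule.Quotient.mk_surjective _ v
    change (Submodule.Quotient.mk (central σ F * v) : CyclicModule f) = 0
    rw [Submodule.Quotient.mk_eq_zero, central_mul_comm, hg, ← mul_assoc]
    exact Ideal.mul_mem_left _ _ (Ideal.mem_span_singleton_self f)
  · rw [Ne, Module.annihilator_eq_top_iff]
    exact not_subsingleton _

theorem basisMatrix_eq_zero_iff (hσ : ∀ τ : L ≃ₐ[K] L, τ ∈ Subgroup.zpowers σ)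
    {F : Polynomial K} (hF : Irreducible F) (hF0 : F.coeff 0 ≠ 0) {f g : SkewPoly σ}
    (hf : Irreducible f) (hg : central σ F = g * f) {m : ℕ}
    (b : Module.Basis (Fin m) (Eigenring K f)ᵐᵒᵖ (CyclicModule f)) (a : SkewPoly σ) :
    basisMatrix b a = 0 ↔ a ∈ Ideal.span {central σ F} := by
  rw [basisMatrix_eq_zero, annihilator_cyclicModule hσ hF hF0 hf hg]

theorem exists_isCanonical (hσ : ∀ τ : L ≃ₐ[K] L, τ ∈ Subgroup.zpowers σ)
    {F : Polynomial K} (hF : Irreducible F) (hF0 : F.coeff 0 ≠ 0) {f g : SkewPoly σ}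
    (hf : Irreducible f) (hg : central σ F = g * f) {m : ℕ}
    (b : Module.Basis (Fin m) (Eigenring K f)ᵐᵒᵖ (CyclicModule f)) :
    ∃ Φ : Quot σ F ≃ₐ[K] Matrix (Fin m) (Fin m) (Eigenring K f), IsCanonical Φ := by
  have := isSimpleModule_of_irreducible hf
  have h0 := basisMatrix_eq_zero_iff hσ hF hF0 hf hg b
  let φ : Quot σ F →ₐ[K] Matrix (Fin m) (Fin m) (Eigenring K f) :=
    Ideal.Quotient.liftₐ _ (basisMatrix b) fun a ha => (h0 a).2 ha
  have hφ (a : SkewPoly σ) : φ (Submodule.Quotient.mk a) = basisMatrix b a := rfl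
  refine ⟨AlgEquiv.ofBijective φ ⟨?_, ?_⟩, b, ?_⟩
  · rw [injective_iff_map_eq_zero]
    intro a ha
    obtain ⟨a, rfl⟩ := Submodule.Quotient.mk_surjective _ a
    rw [hφ, h0] at ha
    exact (Submodule.Quotient.mk_eq_zero _).2 ha
  · intro M
    obtain ⟨a, ha⟩ := basisMatrix_surjective b M
    exact ⟨Submodule.Quotient.mk a, by rw [hφ, ha]⟩
  · intro a j
    exact smul_basis_eq b a j

/-- `R / R F(x ^ n)` is a power of the simple module `R / R f`. -/
theorem exists_quot_equiv_pi (hσ : ∀ τ : L ≃ₐ[K] L, τ ∈ Subgroup.zpowers σ)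
    {F : Polynomial K} (hF : Irreducible F) (hF0 : F.coeff 0 ≠ 0) {f g : SkewPoly σ}
    (hf : Irreducible f) (hg : central σ F = g * f) {m : ℕ}
    (b : Module.Basis (Fin m) (Eigenring K f)ᵐᵒᵖ (CyclicModule f)) :
    Nonempty (CyclicModule (central σ F) ≃ₗ[SkewPoly σ] (Fin m → CyclicModule f)) := by
  have := isSimpleModule_of_irreducible hf
  let ψ : SkewPoly σ →ₗ[SkewPoly σ] (Fin m → CyclicModule f) :=
    LinearMap.pi fun j => LinearMap.toSpanSingleton (SkewPoly σ) (CyclicModule f) (b j)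
  have hψ (a : SkewPoly σ) (j : Fin m) : ψ a j = a • b j := rfl
  have hs : Function.Surjective ψ := fun w => by
    obtain ⟨a, ha⟩ := exists_smul_basis_eq K f b w
    exact ⟨a, funext ha⟩
  have hk : Ideal.span {central σ F} = LinearMap.ker ψ := by
    ext a
    rw [← annihilator_cyclicModule hσ hF hF0 hf hg, LinearMap.mem_ker, Module.mem_annihilator]
    exact ⟨fun h => funext fun j => h _,
      fun h => smul_eq_zero_of_basis K f b fun j => congrFun h j⟩
  exact ⟨(Submodule.quotEquivOfEq _ _ hk).trans (ψ.quotKerEquivOfSurjective hs)⟩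

/-- The number of irreducible factors of `F(x ^ n)`, as the dimension of `R / R f`. -/
theorem card_eq_of_isProductOfIrreducibles (hσ : ∀ τ : L ≃ₐ[K] L, τ ∈ Subgroup.zpowers σ)
    {F : Polynomial K} (hF : Irreducible F) (hF0 : F.coeff 0 ≠ 0) {f g : SkewPoly σ}
    (hf : Irreducible f) (hg : central σ F = g * f) {m m' : ℕ}
    (b : Module.Basis (Fin m) (Eigenring K f)ᵐᵒᵖ (CyclicModule f))
    (hm : IsProductOfIrreducibles (central σ F) m') : m' = m := by
  have := isSimpleModule_of_irreducible hf
  obtain ⟨e⟩ := exists_quot_equiv_pi hσ hF hF0 hf hg b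
  have h1 := length_eq_of_isProductOfIrreducibles hm
  rw [e.length_eq, Module.length_pi, Module.length_eq_one, mul_one, ENat.card_eq_coe_fintype_card,
    Fintype.card_fin] at h1
  exact_mod_cast h1.symm

theorem mul_finrank_cyclicModule (hσ : ∀ τ : L ≃ₐ[K] L, τ ∈ Subgroup.zpowers σ)
    {F : Polynomial K} (hF : Irreducible F) (hF0 : F.coeff 0 ≠ 0) {f g : SkewPoly σ}
    (hf : Irreducible f) (hg : central σ F = g * f) {m : ℕ}
    (b : Module.Basis (Fin m) (Eigenring K f)ᵐᵒᵖ (CyclicModule f)) :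
    m * Module.finrank K (CyclicModule f) =
      Module.finrank K L * (F.natDegree * Module.finrank K L) := by
  have := finite_cyclicModule hf.ne_zero
  obtain ⟨e⟩ := exists_quot_equiv_pi hσ hF hF0 hf hg b
  rw [← (finrank_cyclicModule (hasDeg_central (σ := σ) hF.ne_zero)).2,
    (e.restrictScalars K).finrank_eq, Module.finrank_pi_fintype]
  simp

theorem natDegree_dvd_finrank_eigenring {F : Polynomial K} (hF : Irreducible F)
    {f g : SkewPoly σ} (hg : central σ F = g * f) :
    F.natDegree ∣ Module.finrank K (Eigenring K f) := by
  have hmem : mono σ (Module.finrank K L) 1 ∈ idealiser K f := by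
    have := central_mul_comm σ Polynomial.X f
    rw [central, Polynomial.aeval_X] at this
    change f * _ ∈ Ideal.span {f}
    rw [← this]
    exact Ideal.mul_mem_left _ _ (Ideal.mem_span_singleton_self f)
  let y : idealiser K f := ⟨_, hmem⟩
  have hy : ((Polynomial.aeval y F : idealiser K f) : SkewPoly σ) = central σ F :=
    (Polynomial.aeval_algHom_apply (idealiser K f).val y F).symm
  have hy0 : Polynomial.aeval (Ideal.Quotient.mkₐ K (idealiserIdeal K f) y) F = 0 := by
    rw [Polynomial.aeval_algHom_apply]
    refine Ideal.Quotient.eq_zero_iff_mem.2 ?_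
    rw [mem_idealiserIdeal, hy, hg]
    exact Ideal.mul_mem_left _ _ (Ideal.mem_span_singleton_self f)
  exact natDegree_dvd_finrank_of_aeval_eq_zero hF hy0

theorem eigenring_dimensions (hσ : ∀ τ : L ≃ₐ[K] L, τ ∈ Subgroup.zpowers σ)
    {F : Polynomial K} (hF : Irreducible F) (hF0 : F.coeff 0 ≠ 0) {f g : SkewPoly σ}
    (hf : Irreducible f) (hg : central σ F = g * f) {m : ℕ}
    (b : Module.Basis (Fin m) (Eigenring K f)ᵐᵒᵖ (CyclicModule f)) :
    Module.finrank K L = m * (Module.finrank K L / m) ∧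
      Module.finrank K (Eigenring K f) = F.natDegree * (Module.finrank K L / m) ^ 2 := by
  have h1 := mul_finrank_cyclicModule hσ hF hF0 hf hg b
  rw [finrank_cyclicModule_eq hf b] at h1
  obtain ⟨e, he⟩ := natDegree_dvd_finrank_eigenring hF hg
  have hs : 0 < F.natDegree := hF.natDegree_pos
  have hn : 0 < Module.finrank K L := Module.finrank_pos
  set n := Module.finrank K L
  set s := F.natDegree
  rw [he] at h1 ⊢
  -- With `[𝓔(f) : K] = s e`, the dimension count reads `m ^ 2 s e = s n ^ 2`. Then `m ^ 2 ∣ n ^ 2`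
  -- forces `m ∣ n`, and `e` is the square of the quotient.
  have h2 : m ^ 2 * e = n ^ 2 := by
    apply Nat.eq_of_mul_eq_mul_left hs
    linarith
  obtain ⟨l, hl⟩ := (Nat.pow_dvd_pow_iff two_ne_zero).1 (Dvd.intro _ h2)
  have hm : 0 < m := by
    rcases Nat.eq_zero_or_pos m with rfl | h
    · omega
    · exact h
  rw [hl, Nat.mul_div_cancel_left l hm]
  refine ⟨rfl, ?_⟩
  rw [hl, mul_pow] at h2
  rw [Nat.eq_of_mul_eq_mul_left (pow_pos hm 2) h2]

end Structure

end SkewPoly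


namespace SkewPoly

/-! ### Ring homomorphisms out of `L[x; σ]` -/

section Eval

variable {K L : Type*} [Field K] [Field L] [Algebra K L] {σ : L ≃ₐ[K] L} {S : Type*} [Ring S]

theorem map_pow_apply_mul_pow (φ : L →+* S) (P : S) (h : ∀ a, φ (σ a) * P = P * φ a) (i : ℕ)
    (a : L) : φ ((σ ^ i) a) * P ^ i = P ^ i * φ a := by
  induction i generalizing a with
  | zero => simp
  | succ i ih => rw [pow_succ P, mul_assoc (P ^ i), ← h, ← mul_assoc, ← mul_assoc, ← ih,
      pow_succ, AlgEquiv.mul_apply]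

/-- The ring homomorphism on `L[x; σ]` that extends `φ` and sends `x` to `P`. -/
def evalHom (φ : L →+* S) (P : S) (h : ∀ a, φ (σ a) * P = P * φ a) : SkewPoly σ →+* S :=
  SkewMonoidAlgebra.liftNCRingHom (φ.comp ((toCoeff σ).symm : SkewCoeff σ →+* L))
    (powersHom S P) (by
      intro a i
      exact map_pow_apply_mul_pow φ P h i.toAdd ((toCoeff σ).symm a))

variable (φ : L →+* S) (P : S) (h : ∀ a, φ (σ a) * P = P * φ a)

theorem evalHom_mono (i : ℕ) (a : L) : evalHom φ P h (mono σ i a) = φ a * P ^ i :=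
  SkewMonoidAlgebra.liftNC_single _ _ _ _

theorem evalHom_eq_sum {N : ℕ} {g : SkewPoly σ} (hg : g ∈ degLT σ N) :
    evalHom φ P h g = ∑ i ∈ Finset.range N, φ (cf i g) * P ^ i := by
  conv_lhs => rw [eq_sum_mono hg, map_sum]
  exact Finset.sum_congr rfl fun i _ => evalHom_mono φ P h i _

theorem evalHom_central (F : Polynomial K) : evalHom φ P h (central σ F) =
    F.sum fun i c => φ (algebraMap K L c) * (P ^ Module.finrank K L) ^ i := by
  rw [central_eq_sum, Polynomial.sum_def, map_sum, Polynomial.sum_def]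
  refine Finset.sum_congr rfl fun i _ => ?_
  rw [evalHom_mono, mul_comm i, pow_mul]

end Eval

/-! ### The reduced norm and its extreme coefficients -/

section Norm

open Polynomial

variable {K L : Type*} [Field K] [Field L] [Algebra K L] (σ : L ≃ₐ[K] L)

/-- `L` acts on `n`-tuples of polynomials through the powers of `σ`. -/
def conjDiag (n : ℕ) : L →+* Matrix (Fin n) (Fin n) L[X] :=
  (Matrix.diagonalRingHom (Fin n) L[X]).comp
    (RingHom.pi fun k => (C : L →+* L[X]).comp ((σ ^ (k : ℕ) : L ≃ₐ[K] L) : L →+* L))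

theorem conjDiag_apply (n : ℕ) (a : L) :
    conjDiag σ n a = Matrix.diagonal fun k : Fin n => C ((σ ^ (k : ℕ)) a) := rfl

/-- The matrix of the cyclic shift. -/
def cyc (A : Type*) [CommRing A] (n : ℕ) : Matrix (Fin n) (Fin n) A :=
  (finRotate n).permMatrix A

theorem cyc_apply (A : Type*) [CommRing A] {n : ℕ} (k l : Fin n) :
    cyc A n k l = if l = finRotate n k then 1 else 0 := by
  simp [cyc, PEquiv.toMatrix_apply, eq_comm]

theorem finRotate_val {n : ℕ} (k : Fin n) :
    ((finRotate n k : Fin n) : ℕ) = if (k : ℕ) + 1 = n then 0 else (k : ℕ) + 1 := by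
  rcases n with _ | n
  · exact k.elim0
  · rw [coe_finRotate]
    simp [Fin.ext_iff]

theorem det_cyc (A : Type*) [CommRing A] (n : ℕ) : (cyc A n).det = (-1) ^ (n - 1) := by
  rw [cyc, Matrix.det_permutation, sign_finRotate]
  simp

theorem finRotate_pow_self (n : ℕ) : finRotate n ^ n = 1 := by
  rcases Nat.lt_or_ge n 2 with h | h
  · interval_cases n
    · rfl
    · rw [pow_one, finRotate_one]; rfl
  · have := pow_orderOf_eq_one (finRotate n)
    rwa [(isCycle_finRotate_of_le h).orderOf, support_finRotate_of_le h, Finset.card_univ,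
      Fintype.card_fin] at this

theorem cyc_pow (A : Type*) [CommRing A] (n i : ℕ) :
    cyc A n ^ i = (finRotate n ^ i).permMatrix A := by
  induction i with
  | zero => simp
  | succ i ih => rw [pow_succ', pow_succ, Matrix.permMatrix_mul, ih, cyc]

theorem cyc_pow_self (A : Type*) [CommRing A] (n : ℕ) : cyc A n ^ n = 1 := by
  rw [cyc_pow, finRotate_pow_self, Matrix.permMatrix_one]

/-- In row `k` both sides have the entry `σ ^ (k + 1)(a)`; the wrap-around in the last row is where
`σ ^ n = 1` enters. -/
theorem conjDiag_mul_cyc {n : ℕ} (hn : σ ^ n = 1) (a : L) :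
    conjDiag σ n (σ a) * cyc L[X] n = cyc L[X] n * conjDiag σ n a := by
  ext1 k l
  rw [conjDiag_apply, conjDiag_apply, Matrix.diagonal_mul, Matrix.mul_diagonal, cyc_apply]
  split_ifs with h
  · rw [mul_one, one_mul, h, finRotate_val]
    split_ifs with hk
    · rw [← AlgEquiv.mul_apply, ← pow_succ, hk, hn, pow_zero]
    · rw [pow_succ, AlgEquiv.mul_apply]
  · rw [mul_zero, zero_mul]

/-- The shift with the entry `X` in the last row. -/
def companionX (L : Type*) [Field L] (n : ℕ) : Matrix (Fin n) (Fin n) L[X] :=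
  Matrix.diagonal (fun k : Fin n => if (k : ℕ) + 1 = n then (X : L[X]) else 1) * cyc L[X] n

theorem conjDiag_mul_companionX {n : ℕ} (hn : σ ^ n = 1) (a : L) :
    conjDiag σ n (σ a) * companionX L n = companionX L n * conjDiag σ n a := by
  rw [companionX, mul_assoc, ← conjDiag_mul_cyc σ hn, ← mul_assoc, ← mul_assoc, conjDiag_apply,
    Matrix.diagonal_mul_diagonal, Matrix.diagonal_mul_diagonal]
  simp_rw [mul_comm]

theorem conjDiag_mul_X_smul_cyc {n : ℕ} (hn : σ ^ n = 1) (a : L) :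
    conjDiag σ n (σ a) * ((X : L[X]) • cyc L[X] n) =
      ((X : L[X]) • cyc L[X] n) * conjDiag σ n a := by
  rw [Matrix.mul_smul, Matrix.smul_mul, conjDiag_mul_cyc σ hn]

/-- The representation of `L[x; σ]` on its basis `1, x, …, x ^ (n - 1)` over `L[x ^ n]`. -/
def regRep {n : ℕ} (hn : σ ^ n = 1) : SkewPoly σ →+* Matrix (Fin n) (Fin n) L[X] :=
  evalHom (conjDiag σ n) (companionX L n) (conjDiag_mul_companionX σ hn)

/-- The representation of `L[x; σ]` that maps `x` to the multiple by `X` of the cyclic shift. -/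
def shiftRep {n : ℕ} (hn : σ ^ n = 1) : SkewPoly σ →+* Matrix (Fin n) (Fin n) L[X] :=
  evalHom (conjDiag σ n) ((X : L[X]) • cyc L[X] n) (conjDiag_mul_X_smul_cyc σ hn)

variable {σ}

/-- In this representation the exponent of `X` records the degree in `x`, so the extreme
coefficients of the determinant can be read off. `regRep` instead has `X` standing for `x ^ n`. -/
theorem shiftRep_coeff {n : ℕ} (hn : σ ^ n = 1) {g : SkewPoly σ} (i : ℕ) (k l : Fin n) :
    (shiftRep σ hn g k l).coeff i = (σ ^ (k : ℕ)) (cf i g) * (cyc L n ^ i) k l := by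
  obtain ⟨N, hg⟩ := exists_mem_degLT g
  have hcyc (j : ℕ) : (cyc L[X] n ^ j) k l = C ((cyc L n ^ j) k l) := by
    rw [cyc_pow, cyc_pow]
    simp [PEquiv.toMatrix_apply, apply_ite C]
  have hterm (j : ℕ) : (conjDiag σ n (cf j g) * ((X : L[X]) • cyc L[X] n) ^ j) k l =
      monomial j ((σ ^ (k : ℕ)) (cf j g) * (cyc L n ^ j) k l) := by
    rw [_root_.smul_pow, Matrix.mul_smul, Matrix.smul_apply, conjDiag_apply, Matrix.diagonal_mul, hcyc,
      ← C_mul, smul_eq_mul, mul_comm, C_mul_X_pow_eq_monomial]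
  rw [shiftRep, evalHom_eq_sum _ _ _ hg, Matrix.sum_apply, finsetSum_coeff]
  simp_rw [hterm, coeff_monomial]
  rw [Finset.sum_ite_eq']
  split_ifs with hi
  · rfl
  · rw [hg i (by simpa using hi), map_zero, zero_mul]

theorem prod_pow_eq_norm [FiniteDimensional K L] [IsGalois K L]
    (hσ : ∀ τ : L ≃ₐ[K] L, τ ∈ Subgroup.zpowers σ) (a : L) :
    ∏ k : Fin (Module.finrank K L), (σ ^ (k : ℕ)) a = algebraMap K L (Algebra.norm K a) := by
  rw [Algebra.norm_eq_prod_automorphisms]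
  have hbij : Function.Bijective fun k : Fin (Module.finrank K L) => σ ^ (k : ℕ) := by
    rw [Fintype.bijective_iff_injective_and_card]
    constructor
    · intro k l h
      have ho := orderOf_eq_finrank hσ
      exact Fin.ext (pow_injOn_Iio_orderOf (by simp [ho]) (by simp [ho]) h)
    · rw [Fintype.card_fin, ← Nat.card_eq_fintype_card, IsGalois.card_aut_eq_finrank]
  exact hbij.prod_comp fun τ : L ≃ₐ[K] L => τ a

theorem det_shiftRep_coeff_zero [FiniteDimensional K L] [IsGalois K L]
    (hσ : ∀ τ : L ≃ₐ[K] L, τ ∈ Subgroup.zpowers σ) (g : SkewPoly σ) :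
    (shiftRep σ (pow_finrank_eq_one σ) g).det.coeff 0 =
      algebraMap K L (Algebra.norm K (cf 0 g)) := by
  rw [← prod_pow_eq_norm hσ, ← Matrix.det_diagonal, coeff_zero_eq_eval_zero,
    ← coe_evalRingHom, RingHom.map_det]
  congr 1
  ext k l
  rw [RingHom.mapMatrix_apply, Matrix.map_apply, coe_evalRingHom, ← coeff_zero_eq_eval_zero,
    shiftRep_coeff, pow_zero, Matrix.one_apply, Matrix.diagonal_apply]
  split_ifs <;> simp

theorem natDegree_shiftRep_le {n : ℕ} (hn : σ ^ n = 1) {g : SkewPoly σ} {d : ℕ}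
    (hg : g ∈ degLT σ (d + 1)) (k l : Fin n) : (shiftRep σ hn g k l).natDegree ≤ d := by
  rw [natDegree_le_iff_coeff_eq_zero]
  intro i hi
  rw [shiftRep_coeff, hg i hi, map_zero, zero_mul]

theorem natDegree_det_shiftRep_le {n : ℕ} (hn : σ ^ n = 1) {g : SkewPoly σ} {d : ℕ}
    (hg : g ∈ degLT σ (d + 1)) : (shiftRep σ hn g).det.natDegree ≤ n * d := by
  rw [Matrix.det_apply]
  refine natDegree_sum_le_of_forall_le _ _ fun τ _ => ?_
  refine (natDegree_smul_le _ _).trans ((natDegree_prod_le _ _).trans ?_)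
  refine (Finset.sum_le_card_nsmul _ _ d fun k _ => natDegree_shiftRep_le hn hg _ _).trans ?_
  simp

/-- All entries have degree at most `d`, so the coefficient of `X ^ (n d)` in each Leibniz term is
the product of the coefficients of `X ^ d`. These form the matrix of a diagonal times the `d`-th
power of the cyclic shift. -/
theorem det_shiftRep_coeff_top [FiniteDimensional K L] [IsGalois K L]
    (hσ : ∀ τ : L ≃ₐ[K] L, τ ∈ Subgroup.zpowers σ) {g : SkewPoly σ} {d : ℕ}
    (hg : g ∈ degLT σ (d + 1)) :
    (shiftRep σ (pow_finrank_eq_one σ) g).det.coeff (Module.finrank K L * d) =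
      algebraMap K L (Algebra.norm K (cf d g)) * ((-1) ^ (Module.finrank K L - 1)) ^ d := by
  rw [← prod_pow_eq_norm hσ, ← det_cyc, ← Matrix.det_pow, ← Matrix.det_diagonal, ← Matrix.det_mul,
    Matrix.det_apply, Matrix.det_apply, finsetSum_coeff]
  refine Finset.sum_congr rfl fun τ _ => ?_
  rw [coeff_smul]
  congr 1
  have := coeff_prod_of_natDegree_le (s := Finset.univ)
    (fun k => shiftRep σ (pow_finrank_eq_one σ) g (τ k) k) d
    fun k _ => natDegree_shiftRep_le _ hg _ _
  rw [Finset.card_univ, Fintype.card_fin] at this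
  rw [this]
  refine Finset.prod_congr rfl fun k _ => ?_
  rw [shiftRep_coeff, Matrix.diagonal_mul]

/-- After `X ↦ X ^ n`, the matrix `diag(1, X, …, X ^ (n - 1))` intertwines the two images of `x`; in
the last row this is `X ^ n · 1 = X ^ (n - 1) · X`. Hence `regRep` and `shiftRep` have the same
determinant up to this substitution. -/
theorem expand_companionX_mul {n : ℕ} :
    (expand L n : L[X] →+* L[X]).mapMatrix (companionX L n) *
        Matrix.diagonal (fun k : Fin n => (X : L[X]) ^ (k : ℕ)) =
      Matrix.diagonal (fun k : Fin n => (X : L[X]) ^ (k : ℕ)) * ((X : L[X]) • cyc L[X] n) := by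
  ext1 k l
  rw [Matrix.mul_diagonal, Matrix.diagonal_mul, RingHom.mapMatrix_apply, Matrix.map_apply,
    companionX, Matrix.diagonal_mul, Matrix.smul_apply, cyc_apply]
  split_ifs with hk h h
  · rw [h, finRotate_val, if_pos hk]
    conv_lhs => rw [mul_one, pow_zero, mul_one]
    change expand L n X = _
    rw [expand_X]
    conv_lhs => rw [← hk]
    rw [pow_succ, smul_eq_mul, mul_one]
  · simp
  · rw [h, finRotate_val, if_neg hk]
    simp [pow_succ]
  · simp

theorem expand_regRep_mul {n : ℕ} (hn : σ ^ n = 1) (g : SkewPoly σ) :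
    (expand L n : L[X] →+* L[X]).mapMatrix (regRep σ hn g) *
        Matrix.diagonal (fun k : Fin n => (X : L[X]) ^ (k : ℕ)) =
      Matrix.diagonal (fun k : Fin n => (X : L[X]) ^ (k : ℕ)) * shiftRep σ hn g := by
  obtain ⟨N, hg⟩ := exists_mem_degLT g
  rw [regRep, shiftRep, evalHom_eq_sum _ _ _ hg, evalHom_eq_sum _ _ _ hg, map_sum, Finset.sum_mul,
    Finset.mul_sum]
  refine Finset.sum_congr rfl fun i _ => ?_
  have h1 (j : ℕ) : (expand L n : L[X] →+* L[X]).mapMatrix (companionX L n) ^ j *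
      Matrix.diagonal (fun k : Fin n => (X : L[X]) ^ (k : ℕ)) =
      Matrix.diagonal (fun k : Fin n => (X : L[X]) ^ (k : ℕ)) *
        ((X : L[X]) • cyc L[X] n) ^ j := by
    induction j with
    | zero => rw [pow_zero, pow_zero, one_mul, mul_one]
    | succ j ih => rw [pow_succ, pow_succ, mul_assoc, expand_companionX_mul, ← mul_assoc, ih,
        mul_assoc]
  have h2 (a : L) : (expand L n : L[X] →+* L[X]).mapMatrix (conjDiag σ n a) = conjDiag σ n a := by
    rw [conjDiag_apply, RingHom.mapMatrix_apply, Matrix.diagonal_map (map_zero _)]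
    congr 1
    ext1 k
    exact expand_C _ _
  rw [map_mul, map_pow, mul_assoc, h1, h2, ← mul_assoc, ← mul_assoc, conjDiag_apply,
    Matrix.diagonal_mul_diagonal, Matrix.diagonal_mul_diagonal]
  simp_rw [mul_comm]

theorem expand_det_regRep {n : ℕ} (hn : σ ^ n = 1) (g : SkewPoly σ) :
    expand L n (regRep σ hn g).det = (shiftRep σ hn g).det := by
  have h := congrArg Matrix.det (expand_regRep_mul hn g)
  rw [Matrix.det_mul, Matrix.det_mul, mul_comm, ← RingHom.map_det] at h
  refine mul_left_cancel₀ ?_ h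
  rw [Matrix.det_diagonal, Finset.prod_ne_zero_iff]
  exact fun k _ => pow_ne_zero _ X_ne_zero

theorem det_regRep_central [FiniteDimensional K L] [IsGalois K L] (F : K[X]) :
    (regRep σ (pow_finrank_eq_one σ) (central σ F)).det =
      (F.map (algebraMap K L)) ^ Module.finrank K L := by
  have hn : 0 < Module.finrank K L := Module.finrank_pos
  apply expand_injective hn
  rw [expand_det_regRep, shiftRep, evalHom_central, _root_.smul_pow, cyc_pow_self, Polynomial.sum_def]
  have : (∑ i ∈ F.support, conjDiag σ (Module.finrank K L) (algebraMap K L (F.coeff i)) *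
      ((X : L[X]) ^ Module.finrank K L • (1 : Matrix (Fin (Module.finrank K L))
        (Fin (Module.finrank K L)) L[X])) ^ i) = Matrix.diagonal fun _ =>
        expand L (Module.finrank K L) (F.map (algebraMap K L)) := by
    ext1 k l
    rw [Matrix.sum_apply]
    simp_rw [_root_.smul_pow, one_pow, Matrix.mul_smul, mul_one, Matrix.smul_apply, conjDiag_apply,
      AlgEquiv.commutes, Matrix.diagonal_apply]
    split_ifs
    · conv_rhs => rw [F.as_sum_support]
      simp only [Polynomial.map_sum, map_sum, map_monomial, expand_monomial, smul_eq_mul]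
      refine Finset.sum_congr rfl fun i _ => ?_
      rw [mul_comm, ← pow_mul, C_mul_X_pow_eq_monomial, mul_comm]
    · simp
  rw [this, Matrix.det_diagonal, Finset.prod_const, Finset.card_univ, Fintype.card_fin, map_pow]

/-- Applying `σ` to the coefficients of `regRep g` amounts to conjugating by the image of `x`, whose
determinant is nonzero. -/
theorem map_det_regRep [FiniteDimensional K L] [IsGalois K L] (g : SkewPoly σ) :
    (regRep σ (pow_finrank_eq_one σ) g).det.map (σ : L →+* L) =
      (regRep σ (pow_finrank_eq_one σ) g).det := by
  set n := Module.finrank K L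
  have hn := pow_finrank_eq_one σ
  obtain ⟨N, hg⟩ := exists_mem_degLT g
  have hP : (mapRingHom (σ : L →+* L)).mapMatrix (companionX L n) = companionX L n := by
    ext1 k l
    rw [RingHom.mapMatrix_apply, Matrix.map_apply, companionX, Matrix.diagonal_mul, cyc_apply,
      coe_mapRingHom]
    split_ifs <;> simp
  have hd (a : L) : (mapRingHom (σ : L →+* L)).mapMatrix (conjDiag σ n a) =
      conjDiag σ n (σ a) := by
    rw [conjDiag_apply, RingHom.mapMatrix_apply, Matrix.diagonal_map (map_zero _), conjDiag_apply]
    congr 1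
    ext1 k
    simp only [coe_mapRingHom, map_C, RingHom.coe_coe]
    rw [← AlgEquiv.mul_apply, ← AlgEquiv.mul_apply, ← pow_succ, ← pow_succ']
  have hcomm : (mapRingHom (σ : L →+* L)).mapMatrix (regRep σ hn g) * companionX L n =
      companionX L n * regRep σ hn g := by
    rw [regRep, evalHom_eq_sum _ _ _ hg, map_sum, Finset.sum_mul, Finset.mul_sum]
    refine Finset.sum_congr rfl fun i _ => ?_
    rw [map_mul, map_pow, hP, hd, mul_assoc, ← pow_succ, pow_succ', ← mul_assoc,
      conjDiag_mul_companionX σ hn, mul_assoc]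
  have h := congrArg Matrix.det hcomm
  rw [Matrix.det_mul, Matrix.det_mul, mul_comm, ← RingHom.map_det] at h
  refine mul_left_cancel₀ ?_ h
  rw [companionX, Matrix.det_mul, Matrix.det_diagonal, det_cyc]
  refine mul_ne_zero (Finset.prod_ne_zero_iff.2 fun k _ => ?_) (pow_ne_zero _ (by simp))
  split_ifs
  · exact X_ne_zero
  · exact one_ne_zero

/-- The reduced norm of a skew polynomial has coefficients in `K`. -/
theorem exists_map_eq_det_regRep [FiniteDimensional K L] [IsGalois K L]
    (hσ : ∀ τ : L ≃ₐ[K] L, τ ∈ Subgroup.zpowers σ) (g : SkewPoly σ) :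
    ∃ N : K[X], N.map (algebraMap K L) = (regRep σ (pow_finrank_eq_one σ) g).det := by
  rw [← mem_lifts, lifts_iff_coeff_lifts]
  intro i
  obtain ⟨c, hc⟩ := mem_range_of_fixed hσ
    (a := (regRep σ (pow_finrank_eq_one σ) g).det.coeff i) (by
      conv_rhs => rw [← map_det_regRep]
      rw [coeff_map]; rfl)
  exact ⟨c, hc⟩

/-- The norm of the constant coefficient of a left divisor of `F(x ^ n)`. -/
theorem norm_cf_zero_of_mul_eq_central [FiniteDimensional K L] [IsGalois K L]
    (hσ : ∀ τ : L ≃ₐ[K] L, τ ∈ Subgroup.zpowers σ) (heven : Even (Module.finrank K L))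
    {F : K[X]} (hm : F.Monic) (hF : Irreducible F) {a b : SkewPoly σ}
    (hab : a * b = central σ F) {j : ℕ} (ha : HasDeg a (F.natDegree * j)) :
    Algebra.norm K (cf 0 a) =
      (-1) ^ (F.natDegree * j) * F.coeff 0 ^ j * Algebra.norm K (cf (F.natDegree * j) a) := by
  have hn : 0 < Module.finrank K L := Module.finrank_pos
  have hinj := (algebraMap K L).injective
  obtain ⟨N, hN⟩ := exists_map_eq_det_regRep hσ a
  obtain ⟨M, hM⟩ := exists_map_eq_det_regRep hσ b
  have hNM : N * M = F ^ Module.finrank K L := by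
    apply Polynomial.map_injective _ hinj
    rw [Polynomial.map_mul, hN, hM, ← Matrix.det_mul, ← map_mul, hab, det_regRep_central,
      Polynomial.map_pow]
  have hcoeff (i : ℕ) : algebraMap K L (N.coeff i) =
      (shiftRep σ (pow_finrank_eq_one σ) a).det.coeff (Module.finrank K L * i) := by
    rw [← coeff_map, hN, ← expand_det_regRep, coeff_expand_mul' hn]
  have h0 : N.coeff 0 = Algebra.norm K (cf 0 a) := by
    apply hinj
    rw [hcoeff, mul_zero, det_shiftRep_coeff_zero hσ]
  set d := F.natDegree * j
  -- The sign from the cyclic shift is `(-1) ^ ((n - 1) d)`, which equals `(-1) ^ d` because `n` is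
  -- even.
  have hd : N.coeff d = Algebra.norm K (cf d a) * (-1) ^ d := by
    apply hinj
    rw [hcoeff, det_shiftRep_coeff_top hσ ha.2, Odd.neg_one_pow (Nat.Even.sub_odd hn heven odd_one)]
    simp
  have hdeg : N.natDegree = d := by
    refine natDegree_eq_of_le_of_coeff_ne_zero ?_ ?_
    · rw [natDegree_le_iff_coeff_eq_zero]
      intro i hi
      apply hinj
      rw [hcoeff, map_zero]
      refine coeff_eq_zero_of_natDegree_lt
        ((natDegree_det_shiftRep_le _ ha.2).trans_lt ?_)
      exact Nat.mul_lt_mul_of_pos_left hi hn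
    · rw [hd]
      refine mul_ne_zero ?_ (pow_ne_zero _ (by simp))
      rw [Algebra.norm_ne_zero_iff]
      exact ha.1
  -- `N` divides `F ^ n` with `F` prime, so `N = c F ^ i`; the degree gives `i = j`, and `c` is the
  -- leading coefficient.
  obtain ⟨i, -, hi⟩ := (dvd_prime_pow hF.prime _).1 (Dvd.intro _ hNM)
  obtain ⟨u, hu⟩ := hi.symm
  obtain ⟨c, hc, hcu⟩ := Polynomial.isUnit_iff.1 u.isUnit
  rw [← hcu] at hu
  have hij : i = j := by
    rw [← hu, natDegree_mul_C hc.ne_zero, natDegree_pow, mul_comm] at hdeg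
    exact Nat.eq_of_mul_eq_mul_left hF.natDegree_pos hdeg
  subst hij
  have hlead : N.coeff d = c := by
    have : N.leadingCoeff = c := by
      rw [← hu, leadingCoeff_mul, (hm.pow i).leadingCoeff, leadingCoeff_C, one_mul]
    rw [← this, leadingCoeff, hdeg]
  rw [← h0, ← hu, coeff_mul_C, ← hlead, hd, coeff_zero_eq_eval_zero, eval_pow,
    ← coeff_zero_eq_eval_zero]
  ring

end Norm

end SkewPoly


/-! ### Ranks of matrices over division rings -/

section Rank

variable {K D : Type*} [Field K] [Ring D] [Algebra K D]

/-- The matrix with given columns in the column space of `A`. -/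
def ofColumns {m : ℕ} (W : Submodule Dᵐᵒᵖ (Fin m → D)) :
    (Fin m → W.restrictScalars K) →ₗ[K] Matrix (Fin m) (Fin m) D where
  toFun v := Matrix.of fun i j => (v j : Fin m → D) i
  map_add' _ _ := rfl
  map_smul' _ _ := rfl

theorem ofColumns_apply {m : ℕ} (W : Submodule Dᵐᵒᵖ (Fin m → D))
    (v : Fin m → W.restrictScalars K) (i j : Fin m) :
    ofColumns W v i j = (v j : Fin m → D) i := rfl

/-- The columns of `A B` are independent, arbitrary right combinations of the columns of `A`. -/
theorem range_mulLeft_eq {m : ℕ} (A : Matrix (Fin m) (Fin m) D) :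
    LinearMap.range (LinearMap.mulLeft K A) =
      LinearMap.range (ofColumns (K := K) (Submodule.span Dᵐᵒᵖ (Set.range A.col))) := by
  ext B
  constructor
  · rintro ⟨B, rfl⟩
    have hmem (j : Fin m) : ∑ k, MulOpposite.op (B k j) • A.col k ∈
        Submodule.span Dᵐᵒᵖ (Set.range A.col) :=
      Submodule.sum_mem _ fun k _ => Submodule.smul_mem _ _ (Submodule.subset_span ⟨k, rfl⟩)
    refine ⟨fun j => ⟨_, hmem j⟩, ?_⟩
    ext i j
    rw [ofColumns_apply, LinearMap.mulLeft_apply, Matrix.mul_apply]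
    change (∑ k, MulOpposite.op (B k j) • A.col k) i = _
    rw [Finset.sum_apply]
    rfl
  · rintro ⟨v, rfl⟩
    choose c hc using fun j => (Submodule.mem_span_range_iff_exists_fun Dᵐᵒᵖ).1 (v j).2
    refine ⟨Matrix.of fun k j => (c j k).unop, ?_⟩
    ext i j
    rw [ofColumns_apply, LinearMap.mulLeft_apply, Matrix.mul_apply, ← hc, Finset.sum_apply]
    rfl

variable [Nontrivial D]

theorem rightRank_le_of_col_eq_zero (hu : ∀ a : D, a ≠ 0 → IsUnit a) {m : ℕ}
    {A : Matrix (Fin m) (Fin m) D} {j : ℕ} (hA : ∀ i : Fin m, (i : ℕ) < j → A.col i = 0) :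
    rightRank A ≤ m - j := by
  have := strongRankCondition_of_forall_isUnit (forall_isUnit_op hu)
  have hspan : Submodule.span Dᵐᵒᵖ (Set.range A.col) =
      Submodule.span Dᵐᵒᵖ (Set.range fun i : {i : Fin m // j ≤ (i : ℕ)} => A.col i) := by
    refine le_antisymm (Submodule.span_le.2 ?_) (Submodule.span_mono ?_)
    · rintro _ ⟨i, rfl⟩
      rcases Nat.lt_or_ge i j with h | h
      · rw [hA i h]
        exact Submodule.zero_mem _
      · exact Submodule.subset_span ⟨⟨i, h⟩, rfl⟩
    · rintro _ ⟨i, rfl⟩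
      exact ⟨i, rfl⟩
  rw [rightRank, hspan]
  refine (finrank_range_le_card _).trans ?_
  rw [Fintype.card_subtype]
  have h1 : (Finset.univ.filter fun i : Fin m => j ≤ (i : ℕ)).card ≤ (Finset.Ico j m).card := by
    refine Finset.card_le_card_of_injOn (fun i => (i : ℕ)) ?_ (Fin.val_injective.injOn)
    intro i hi
    simpa using hi
  simpa using h1

variable [Module.Finite K D]

/-- This expresses the rank through the `K`-dimension of a right ideal, an invariant of the algebra
rather than of a choice of matrices. -/
theorem finrank_range_mulLeft (hu : ∀ a : D, a ≠ 0 → IsUnit a) {m : ℕ}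
    (A : Matrix (Fin m) (Fin m) D) :
    Module.finrank K (LinearMap.range (LinearMap.mulLeft K A)) =
      m * (rightRank A * Module.finrank K D) := by
  have hu' := forall_isUnit_op hu
  have := strongRankCondition_of_forall_isUnit hu'
  set W := Submodule.span Dᵐᵒᵖ (Set.range A.col) with hW
  have : Module.Free Dᵐᵒᵖ W := free_of_forall_isUnit hu'
  have : Module.Finite Dᵐᵒᵖ W := Module.Finite.span_of_finite _ (Set.finite_range _)
  have hdim : Module.finrank K (W.restrictScalars K) = rightRank A * Module.finrank K D := by
    have b : Module.Basis (Fin (Module.finrank Dᵐᵒᵖ W)) Dᵐᵒᵖ (W.restrictScalars K) :=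
      Module.finBasis Dᵐᵒᵖ W
    exact finrank_eq_of_basis_op b
  have hinj : Function.Injective (ofColumns (K := K) W) := fun v w h => by
    ext j i
    exact congrFun (congrFun h i) j
  rw [range_mulLeft_eq, LinearMap.finrank_range_of_inj hinj, Module.finrank_pi_fintype]
  simp [hdim]

/-- The Singleton-like bound. -/
theorem exists_rightRank_le (hu : ∀ a : D, a ≠ 0 → IsUnit a) {m k : ℕ} (hk : 0 < k) (hkm : k ≤ m)
    (W : Submodule K (Matrix (Fin m) (Fin m) D))
    (hW : Module.finrank K W = m * k * Module.finrank K D) :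
    ∃ A ∈ W, A ≠ 0 ∧ rightRank A ≤ m - k + 1 := by
  -- Keep only the first `k - 1` columns. The target has dimension `(k - 1) m [D : K]`, less than
  -- that of `W`, so some nonzero element of `W` has these columns zero.
  let p : Matrix (Fin m) (Fin m) D →ₗ[K] (Fin (k - 1) → Fin m → D) :=
    { toFun := fun A j i => A i ⟨j, by omega⟩
      map_add' := fun _ _ => rfl
      map_smul' := fun _ _ => rfl }
  have hD : 0 < Module.finrank K D := Module.finrank_pos
  have hlt : Module.finrank K (Fin (k - 1) → Fin m → D) < Module.finrank K W := by
    rw [hW, Module.finrank_pi_fintype, Finset.sum_const, Finset.card_univ, Fintype.card_fin,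
      Module.finrank_pi_fintype, Finset.sum_const, Finset.card_univ, Fintype.card_fin,
      smul_eq_mul, smul_eq_mul, ← mul_assoc]
    refine Nat.mul_lt_mul_of_pos_right ?_ hD
    rw [mul_comm]
    exact Nat.mul_lt_mul_of_pos_left (by omega) (by omega)
  obtain ⟨A, hA, hA0⟩ := Submodule.exists_mem_ne_zero_of_ne_bot
    (LinearMap.ker_ne_bot_of_finrank_lt (f := p ∘ₗ W.subtype) hlt)
  refine ⟨A, A.2, by simpa using hA0, ?_⟩
  have h := rightRank_le_of_col_eq_zero hu (A := (A : Matrix (Fin m) (Fin m) D)) (j := k - 1)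
    fun i hi => by
      ext l
      exact congrFun (congrFun hA ⟨i, hi⟩) l
  omega

end Rank

namespace SkewPoly

/-! ### The code: dimension and minimum distance -/

section Code

variable {K L : Type*} [Field K] [Field L] [Algebra K L]
  {σ : L ≃ₐ[K] L}

/-- The parametrisation of the skew polynomials `a' + ∑_{0 < i < N} a_i x ^ i + γ a'' x ^ N`. -/
def codeMap (σ : L ≃ₐ[K] L) (L' : IntermediateField K L) (N : ℕ) (γ : L) :
    L' × (Fin (N - 1) → L) × L' →ₗ[K] SkewPoly σ where
  toFun v := monoₗ σ 0 v.1 + ∑ i : Fin (N - 1), monoₗ σ (1 + i) (v.2.1 i) +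
    monoₗ σ N (γ * v.2.2)
  map_add' v w := by
    simp only [Prod.fst_add, Prod.snd_add, Pi.add_apply, map_add, mul_add, AddMemClass.coe_add,
      Finset.sum_add_distrib]
    abel
  map_smul' c v := by
    simp only [Prod.smul_fst, Prod.smul_snd, Pi.smul_apply, IntermediateField.coe_smul,
      mul_smul_comm, map_smul, smul_add, Finset.smul_sum, RingHom.id_apply]

theorem range_codeMap (L' : IntermediateField K L) (N : ℕ) (γ : L) :
    Set.range (codeMap σ L' N γ) = polys σ L' N γ := by
  ext g
  constructor
  · rintro ⟨v, rfl⟩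
    refine ⟨fun i => if h : i - 1 < N - 1 then v.2.1 ⟨i - 1, h⟩ else 0, v.1, v.2.2, ?_⟩
    rw [Finset.sum_Ico_eq_sum_range, Finset.sum_range]
    simp only [add_tsub_cancel_left, Fin.is_lt, dif_pos, Fin.eta]
    rfl
  · rintro ⟨a, a', a'', rfl⟩
    refine ⟨(a', fun i => a (1 + i), a''), ?_⟩
    rw [Finset.sum_Ico_eq_sum_range, Finset.sum_range]
    rfl

theorem cf_zero_codeMap {L' : IntermediateField K L} {N : ℕ} (hN : 0 < N) {γ : L}
    (v : L' × (Fin (N - 1) → L) × L') : cf 0 (codeMap σ L' N γ v) = v.1 := by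
  change cf 0 (mono σ 0 (v.1 : L) + ∑ i : Fin (N - 1), mono σ (1 + i) (v.2.1 i) +
    mono σ N (γ * v.2.2)) = _
  rw [map_add, map_add, cf_mono_self, cf_mono_ne hN.ne', map_sum, Finset.sum_eq_zero, add_zero,
    add_zero]
  exact fun i _ => cf_mono_ne (by omega) _

theorem cf_top_codeMap {L' : IntermediateField K L} {N : ℕ} (hN : 0 < N) {γ : L}
    (v : L' × (Fin (N - 1) → L) × L') : cf N (codeMap σ L' N γ v) = γ * v.2.2 := by
  change cf N (mono σ 0 (v.1 : L) + ∑ i : Fin (N - 1), mono σ (1 + i) (v.2.1 i) +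
    mono σ N (γ * v.2.2)) = _
  rw [map_add, map_add, cf_mono_self, cf_mono_ne hN.ne, map_sum, Finset.sum_eq_zero, add_zero,
    zero_add]
  exact fun i _ => cf_mono_ne (by omega) _

theorem cf_codeMap {L' : IntermediateField K L} {N : ℕ} {γ : L}
    (v : L' × (Fin (N - 1) → L) × L') (j : Fin (N - 1)) :
    cf (1 + j) (codeMap σ L' N γ v) = v.2.1 j := by
  change cf (1 + (j : ℕ)) (mono σ 0 (v.1 : L) + ∑ i : Fin (N - 1), mono σ (1 + i) (v.2.1 i) +
    mono σ N (γ * v.2.2)) = _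
  rw [map_add, map_add, cf_mono_ne (by omega), cf_mono_ne (by omega), map_sum,
    Finset.sum_eq_single j, cf_mono_self, add_zero, zero_add]
  · intro i _ hij
    exact cf_mono_ne (fun h => hij (Fin.ext (by omega))) _
  · simp

theorem codeMap_mem_degLT {L' : IntermediateField K L} {N : ℕ} {γ : L}
    (v : L' × (Fin (N - 1) → L) × L') : codeMap σ L' N γ v ∈ degLT σ (N + 1) := by
  refine Submodule.add_mem _ (Submodule.add_mem _ ?_ (Submodule.sum_mem _ fun i _ => ?_)) ?_
  · exact mono_mem_degLT (by omega) _
  · exact mono_mem_degLT (by omega) _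
  · exact mono_mem_degLT (by omega) _

theorem codeMap_injective {L' : IntermediateField K L} {N : ℕ} (hN : 0 < N) {γ : L} (hγ : γ ≠ 0) :
    Function.Injective (codeMap σ L' N γ) := by
  rw [← LinearMap.ker_eq_bot, LinearMap.ker_eq_bot']
  intro v hv
  have h1 := cf_zero_codeMap hN v (σ := σ) (γ := γ)
  have h2 := cf_top_codeMap hN v (σ := σ) (γ := γ)
  have h3 := cf_codeMap v (σ := σ) (γ := γ)
  rw [hv] at h1 h2
  rw [hv] at h3
  refine Prod.ext ?_ (Prod.ext ?_ ?_)
  · simpa using h1.symm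
  · ext j
    simpa using (h3 j).symm
  · simpa [hγ] using h2.symm

variable [FiniteDimensional K L]

theorem exists_codeD_submodule {F : Polynomial K} (hF : F ≠ 0) {L' : IntermediateField K L}
    (hL' : Module.finrank L' L = 2) {ℓ k : ℕ} {γ : L} (hγ : γ ≠ 0)
    (hN : 0 < F.natDegree * k * ℓ)
    (hlt : F.natDegree * k * ℓ < F.natDegree * Module.finrank K L) :
    ∃ W : Submodule K (Quot σ F), (W : Set (Quot σ F)) = codeD σ L' F ℓ k γ ∧
      Module.finrank K W = Module.finrank K L * (F.natDegree * k * ℓ) := by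
  have hdim : Module.finrank K L' * 2 = Module.finrank K L := by
    rw [← hL', Module.finrank_mul_finrank]
  rw [codeD]
  set N := F.natDegree * k * ℓ
  let π : SkewPoly σ →ₗ[K] Quot σ F := ((Ideal.span {central σ F}).restrictScalars K).mkQ
  have hinj : Function.Injective (π ∘ₗ codeMap σ L' N γ) := by
    rw [← LinearMap.ker_eq_bot, LinearMap.ker_eq_bot']
    intro v hv
    have hv : codeMap σ L' N γ v ∈ Ideal.span {central σ F} := (Submodule.Quotient.mk_eq_zero _).1 hv
    obtain ⟨q, hq⟩ := Ideal.mem_span_singleton'.1 hv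
    have hmem : q * central σ F ∈ degLT σ (F.natDegree * Module.finrank K L) := by
      rw [hq]
      exact degLT_mono hlt (codeMap_mem_degLT v)
    -- The codewords have degree at most `s k ℓ < s n = deg F(x ^ n)`, so none but zero vanishes in
    -- the quotient.
    rw [eq_zero_of_mul_mem_degLT (hasDeg_central hF) hmem, zero_mul] at hq
    exact codeMap_injective hN hγ (hq.symm.trans (map_zero _).symm)
  refine ⟨LinearMap.range (π ∘ₗ codeMap σ L' N γ), ?_, ?_⟩
  · rw [← range_codeMap, LinearMap.coe_range, LinearMap.coe_comp, Set.range_comp]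
    rfl
  · rw [LinearMap.finrank_range_of_inj hinj, Module.finrank_prod, Module.finrank_prod,
      Module.finrank_pi_fintype]
    simp only [Finset.sum_const, Finset.card_univ, Fintype.card_fin, smul_eq_mul]
    -- With `N = M + 1`, the two end coefficients contribute `n / 2` each and the middle ones `M n`,
    -- in total `n N`.
    obtain ⟨M, hM⟩ := Nat.exists_eq_add_of_lt hN
    rw [hM, ← hdim]
    simp only [zero_add, Nat.add_sub_cancel]
    ring

/-- A skew polynomial of small degree that spans a small right ideal modulo `F(x ^ n)` is a left
divisor of `F(x ^ n)`. -/
theorem exists_mul_eq_central [IsGalois K L] {F : Polynomial K} {a : SkewPoly σ}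
    {d N : ℕ} (ha : HasDeg a d) (hd : d ≤ N)
    (h : Module.finrank K L * N ≤ Module.finrank K (Quot σ F ⧸
      LinearMap.range (LinearMap.mulLeft K (Submodule.Quotient.mk a : Quot σ F)))) :
    d = N ∧ ∃ b, a * b = central σ F := by
  set S := LinearMap.range (LinearMap.mulLeft K a)
  set S' := LinearMap.range (LinearMap.mulLeft K (Submodule.Quotient.mk a : Quot σ F))
  obtain ⟨hfin, hS⟩ := finite_quotient S (d := d) fun g => by
    obtain ⟨q, hq⟩ := exists_sub_mul_mem_degLT' ha g
    exact ⟨a * q, ⟨q, rfl⟩, hq⟩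
  let π : SkewPoly σ →ₗ[K] Quot σ F := ((Ideal.span {central σ F}).restrictScalars K).mkQ
  have hπ : S ≤ S'.comap π := by
    rintro _ ⟨q, rfl⟩
    exact ⟨Submodule.Quotient.mk q, rfl⟩
  have hsurj : Function.Surjective (S.mapQ S' π hπ) := by
    intro v
    obtain ⟨v, rfl⟩ := Submodule.Quotient.mk_surjective _ v
    obtain ⟨v, rfl⟩ := Submodule.Quotient.mk_surjective _ v
    exact ⟨Submodule.Quotient.mk v, rfl⟩
  have hle := LinearMap.finrank_le_finrank_of_surjective hsurj
  have hn : 0 < Module.finrank K L := Module.finrank_pos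
  have hdN : N ≤ d := Nat.le_of_mul_le_mul_left (h.trans (hle.trans hS)) hn
  obtain rfl : d = N := le_antisymm hd hdN
  refine ⟨rfl, ?_⟩
  have heq := le_antisymm (hS.trans h) hle
  have : Module.Finite K (Quot σ F ⧸ S') := Module.Finite.of_surjective _ hsurj
  -- Equal dimensions make the surjection `R / a R → R_F / a R_F` injective, so `F(x ^ n)`, which is
  -- zero in the target, lies in `a R`.
  have hinj := (LinearMap.injective_iff_surjective_of_finrank_eq_finrank heq).2 hsurj
  have hmem : central σ F ∈ S := by
    rw [← Submodule.Quotient.mk_eq_zero]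
    apply hinj
    rw [map_zero]
    change Submodule.Quotient.mk (π (central σ F)) = (0 : Quot σ F ⧸ S')
    have : π (central σ F) = 0 :=
      (Submodule.Quotient.mk_eq_zero _).2 (Ideal.mem_span_singleton_self (central σ F))
    rw [this, Submodule.Quotient.mk_zero]
  obtain ⟨b, hb⟩ := hmem
  exact ⟨b, hb⟩

variable [IsGalois K L]

theorem finrank_range_mulLeft_eq {F : Polynomial K} {D : Type*} [Ring D] [Algebra K D] {m : ℕ}
    (Φ : Quot σ F ≃ₐ[K] Matrix (Fin m) (Fin m) D) (a : Quot σ F) :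
    Module.finrank K (LinearMap.range (LinearMap.mulLeft K a)) =
      Module.finrank K (LinearMap.range (LinearMap.mulLeft K (Φ a))) := by
  have h : LinearMap.range (LinearMap.mulLeft K (Φ a)) =
      (LinearMap.range (LinearMap.mulLeft K a)).map Φ.toLinearEquiv.toLinearMap := by
    ext B
    constructor
    · rintro ⟨B, rfl⟩
      refine ⟨a * Φ.symm B, ⟨_, rfl⟩, ?_⟩
      change Φ (a * Φ.symm B) = Φ a * B
      rw [map_mul, AlgEquiv.apply_symm_apply]
    · rintro ⟨_, ⟨b, rfl⟩, rfl⟩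
      exact ⟨Φ b, (map_mul Φ a b).symm⟩
  rw [h]
  exact (LinearEquiv.finrank_map_eq Φ.toLinearEquiv _).symm

/-- The minimum distance of the code. -/
theorem lt_rightRank_of_mem_polys (hσ : ∀ τ : L ≃ₐ[K] L, τ ∈ Subgroup.zpowers σ)
    (heven : Even (Module.finrank K L)) {F : Polynomial K} (hm : F.Monic) (hF : Irreducible F)
    {L' : IntermediateField K L} (hL' : Module.finrank L' L = 2) {γ : L}
    {D : Type*} [Ring D] [Algebra K D] [Nontrivial D] [Module.Finite K D]
    (hu : ∀ a : D, a ≠ 0 → IsUnit a) {m ℓ k : ℕ} (hn : Module.finrank K L = m * ℓ)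
    (hD : Module.finrank K D = F.natDegree * ℓ ^ 2) (hk : 0 < k) (hkm : k < m)
    (hsq : ¬ IsSquare ((-1) ^ (F.natDegree * k * ℓ) * F.coeff 0 ^ (k * ℓ) * Algebra.norm K γ))
    (Φ : Quot σ F ≃ₐ[K] Matrix (Fin m) (Fin m) D) {g : SkewPoly σ}
    (hg : g ∈ polys σ L' (F.natDegree * k * ℓ) γ) (hg0 : g ≠ 0) :
    m - k < rightRank (Φ (Submodule.Quotient.mk g)) := by
  by_contra! hr
  have hs : 0 < F.natDegree := hF.natDegree_pos
  have hl : 0 < ℓ := by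
    rcases Nat.eq_zero_or_pos ℓ with rfl | h
    · have : 0 < Module.finrank K L := Module.finrank_pos
      omega
    · exact h
  have hN : 0 < F.natDegree * k * ℓ := by positivity
  rw [← range_codeMap] at hg
  obtain ⟨v, rfl⟩ := hg
  obtain ⟨d, hdN, hd⟩ := exists_hasDeg_lt (codeMap_mem_degLT v) hg0
  obtain ⟨hfin, hQ⟩ := finrank_quot (σ := σ) hF.ne_zero
  have hrank := finrank_range_mulLeft_eq Φ (Submodule.Quotient.mk (codeMap σ L' _ γ v))
  rw [finrank_range_mulLeft hu] at hrank
  have hquot := Submodule.finrank_quotient_add_finrank (LinearMap.range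
    (LinearMap.mulLeft K (Submodule.Quotient.mk (codeMap σ L' _ γ v) : Quot σ F)))
  rw [hQ, hrank, hD, hn] at hquot
  -- The quotient has dimension at least `m ^ 2 s ℓ ^ 2 - m (m - k) s ℓ ^ 2 = m k s ℓ ^ 2 = n s k
  -- ℓ`, using `n = m ℓ`.
  obtain ⟨rfl, b, hb⟩ := exists_mul_eq_central (F := F) hd (Nat.le_of_lt_succ hdN) (by
    have h1 : m * (rightRank (Φ (Submodule.Quotient.mk (codeMap σ L' _ γ v))) *
        (F.natDegree * ℓ ^ 2)) ≤ m * ((m - k) * (F.natDegree * ℓ ^ 2)) := by gcongr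
    obtain ⟨r, rfl⟩ := Nat.exists_eq_add_of_lt hkm
    rw [show k + r + 1 - k = r + 1 by omega] at h1
    rw [hn]
    nlinarith)
  have hj : F.natDegree * k * ℓ = F.natDegree * (k * ℓ) := mul_assoc _ _ _
  have hd' : HasDeg (codeMap σ L' (F.natDegree * k * ℓ) γ v) (F.natDegree * (k * ℓ)) := by
    rw [← hj]
    exact hd
  have hnorm := norm_cf_zero_of_mul_eq_central hσ heven hm hF hb hd'
  have hc : (v.2.2 : L) ≠ 0 := by
    intro h0
    apply hd.1
    rw [cf_top_codeMap hN, h0, mul_zero]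
  rw [← hj, cf_zero_codeMap hN, cf_top_codeMap hN, map_mul] at hnorm
  -- Norms from `L` of elements of `L'` are squares in `K`, since `[L : L'] = 2`.
  have hL (x : L') : Algebra.norm K (x : L) = Algebra.norm K x ^ 2 := by
    have : (x : L) = algebraMap L' L x := rfl
    rw [this, ← Algebra.norm_norm (S := L'), Algebra.norm_algebraMap, hL', map_pow]
  rw [hL, hL] at hnorm
  have hc' : Algebra.norm K v.2.2 ≠ 0 := by
    rw [Algebra.norm_ne_zero_iff]
    simpa using hc
  refine hsq ⟨Algebra.norm K v.1 / Algebra.norm K v.2.2, ?_⟩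
  field_simp
  linear_combination -hnorm

end Code

end SkewPoly

end

namespace SkewPoly

/-! ### The MRD property and the Trombetti–Zhou case -/

section Main

variable {K L : Type*} [Field K] [Field L] [Algebra K L] {σ : L ≃ₐ[K] L}

theorem central_X_sub_one :
    central σ (Polynomial.X - 1) = SkewPolynomial.X ^ Module.finrank K L - 1 := by
  rw [central, map_sub, Polynomial.aeval_X, map_one]
  congr 1
  exact SkewPolynomial.monomial_one_right_eq_X_pow _

variable [FiniteDimensional K L] [IsGalois K L]

theorem isLinearMRDCode_image_codeD (hσ : ∀ τ : L ≃ₐ[K] L, τ ∈ Subgroup.zpowers σ)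
    (heven : Even (Module.finrank K L)) {F : Polynomial K} (hm : F.Monic) (hF : Irreducible F)
    {L' : IntermediateField K L} (hL' : Module.finrank L' L = 2) {γ : L} (hγ : γ ≠ 0)
    {D : Type*} [Ring D] [Algebra K D] [Nontrivial D] [Module.Finite K D]
    (hu : ∀ a : D, a ≠ 0 → IsUnit a) {m ℓ k : ℕ} (hn : Module.finrank K L = m * ℓ)
    (hD : Module.finrank K D = F.natDegree * ℓ ^ 2) (hk : 0 < k) (hkm : k < m)
    (hsq : ¬ IsSquare ((-1) ^ (F.natDegree * k * ℓ) * F.coeff 0 ^ (k * ℓ) * Algebra.norm K γ))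
    (Φ : Quot σ F ≃ₐ[K] Matrix (Fin m) (Fin m) D) :
    IsLinearMRDCode K (Φ '' codeD σ L' F ℓ k γ) (m - k + 1) := by
  have hs : 0 < F.natDegree := hF.natDegree_pos
  have hl : 0 < ℓ := by
    rcases Nat.eq_zero_or_pos ℓ with rfl | h
    · have : 0 < Module.finrank K L := Module.finrank_pos
      omega
    · exact h
  obtain ⟨W, hW, hWdim⟩ := exists_codeD_submodule (σ := σ) hF.ne_zero hL' hγ
    (k := k) (ℓ := ℓ) (by positivity) (by
      rw [hn, mul_assoc]
      exact Nat.mul_lt_mul_of_pos_left (Nat.mul_lt_mul_of_pos_right hkm hl) hs)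
  set C := W.map Φ.toLinearEquiv.toLinearMap with hCdef
  have hC : (C : Set (Matrix (Fin m) (Fin m) D)) = Φ '' codeD σ L' F ℓ k γ := by
    rw [hCdef, Submodule.map_coe, hW]
    rfl
  have hCdim : Module.finrank K C = m * k * Module.finrank K D := by
    rw [hCdef, LinearEquiv.finrank_map_eq, hWdim, hn, hD]
    ring
  have hmin : ∀ A ∈ C, A ≠ 0 → m - k + 1 ≤ rightRank A := by
    intro A hA hA0
    rw [← SetLike.mem_coe, hC] at hA
    obtain ⟨_, ⟨g, hg, rfl⟩, rfl⟩ := hA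
    refine lt_rightRank_of_mem_polys hσ heven hm hF hL' hu hn hD hk hkm hsq Φ hg ?_
    rintro rfl
    rw [Submodule.Quotient.mk_zero, map_zero] at hA0
    exact hA0 rfl
  refine ⟨inferInstance, hu, inferInstance, ⟨C, hC, ?_⟩, ?_, ?_⟩
  -- For `d = m - k + 1` and `0 < k < m`, truncated subtraction gives `m - d + 1 = k`.
  · rw [hCdim]
    congr 2
    omega
  · obtain ⟨A, hA, hA0, hr⟩ := exists_rightRank_le hu hk hkm.le C hCdim
    refine ⟨A, hC ▸ hA, 0, hC ▸ C.zero_mem, hA0, ?_⟩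
    rw [sub_zero]
    exact le_antisymm (hmin A hA hA0) hr
  · rintro r ⟨A, hA, B, hB, hAB, rfl⟩
    rw [← hC] at hA hB
    exact hmin _ (C.sub_mem hA hB) (sub_ne_zero.2 hAB)

/-- The factor `x - 1` has degree one, so `R / R (x - 1)` has dimension `n` over `K`. Since `R / R
(x ^ n - 1)` has dimension `n ^ 2` and is a power of this module, the number of factors is `n`. -/
theorem isProductOfIrreducibles_X_sub_one (hσ : ∀ τ : L ≃ₐ[K] L, τ ∈ Subgroup.zpowers σ) :
    IsProductOfIrreducibles (central σ (Polynomial.X - 1)) (Module.finrank K L) := by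
  have hF : Irreducible (Polynomial.X - 1 : Polynomial K) := by
    rw [← Polynomial.C_1]
    exact Polynomial.irreducible_X_sub_C 1
  have hF1 : (Polynomial.X - 1 : Polynomial K).natDegree = 1 := by
    rw [← Polynomial.C_1]
    exact Polynomial.natDegree_X_sub_C 1
  have hn : 0 < Module.finrank K L := Module.finrank_pos
  have hdeg := hasDeg_central (σ := σ) hF.ne_zero
  set f : SkewPoly σ := SkewPolynomial.X - 1
  have hf1 : HasDeg f 1 := by
    have h1 : (SkewPolynomial.X : SkewPoly σ) = mono σ 1 1 := rfl
    refine ⟨?_, Submodule.sub_mem _ ?_ ?_⟩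
    · rw [map_sub, h1, cf_mono_self, cf_one]
      simp
    · rw [h1]
      exact mono_mem_degLT one_lt_two _
    · rw [← mono_zero_one]
      exact mono_mem_degLT zero_lt_two _
  have hf := irreducible_of_hasDeg_one hf1
  have hg : central σ (Polynomial.X - 1) =
      (∑ i ∈ Finset.range (Module.finrank K L), (SkewPolynomial.X : SkewPoly σ) ^ i) * f := by
    rw [geom_sum_mul, central_X_sub_one]
  obtain ⟨q, ⟨b⟩⟩ := exists_basis hf
  have hF0 : (Polynomial.X - 1 : Polynomial K).coeff 0 ≠ 0 := by simp
  have hq := mul_finrank_cyclicModule hσ hF hF0 hf hg b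
  rw [(finrank_cyclicModule hf1).2, hF1, mul_one, one_mul] at hq
  obtain ⟨m, hm⟩ := exists_isProductOfIrreducibles hdeg.ne_zero fun hu => by
    have := hdeg.unique (isUnit_iff_hasDeg.1 hu)
    rw [hF1] at this
    omega
  have hmq := card_eq_of_isProductOfIrreducibles hσ hF hF0 hf hg b hm
  rwa [hmq, Nat.eq_of_mul_eq_mul_right hn hq] at hm

theorem norm_isSquare_of_mem {L' : IntermediateField K L} (hL' : Module.finrank L' L = 2) {γ : L}
    (hγ : γ ∈ L') : IsSquare (Algebra.norm K γ) := by
  have : γ = algebraMap L' L ⟨γ, hγ⟩ := rfl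
  rw [this, ← Algebra.norm_norm (S := L'), Algebra.norm_algebraMap, hL', map_pow]
  exact IsSquare.sq _

end Main

end SkewPoly

theorem mainTheorem7 {K L : Type*} [Field K] [Field L] [Algebra K L] [FiniteDimensional K L]
    [IsGalois K L] (σ : L ≃ₐ[K] L) (hσ : ∀ τ : L ≃ₐ[K] L, τ ∈ Subgroup.zpowers σ)
    (n t : ℕ) (hn : n = Module.finrank K L) (ht : n = 2 * t)
    (L' : IntermediateField K L) (hL' : Module.finrank L' L = 2)
    (k : ℕ) (hk : 0 < k) (γ : L) :
    (∀ (F : Polynomial K) (f : SkewPoly σ) (s m ℓ : ℕ),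
      F.Monic → Irreducible F → F ≠ Polynomial.X → s = F.natDegree →
      SkewPoly.IsProductOfIrreducibles (SkewPoly.central σ F) m → ℓ = n / m →
      SkewPoly.IsMonic f → Irreducible f → (∃ g, SkewPoly.central σ F = g * f) →
      f ∉ Subring.center (SkewPoly σ) →
      k < m → γ ∉ L' →
      ¬ IsSquare ((-1) ^ (s * k * ℓ) * F.coeff 0 ^ (k * ℓ) * Algebra.norm K γ) →
      n = m * ℓ ∧
      (∃ Φ : SkewPoly.Quot σ F ≃ₐ[K] Matrix (Fin m) (Fin m) (Eigenring K f),
        SkewPoly.IsCanonical Φ) ∧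
      ∀ Φ : SkewPoly.Quot σ F ≃ₐ[K] Matrix (Fin m) (Fin m) (Eigenring K f),
        IsLinearMRDCode K (Φ '' SkewPoly.codeD σ L' F ℓ k γ) (m - k + 1)) ∧
    (k < n → ¬ IsSquare (Algebra.norm K γ) →
      γ ∉ L' ∧
      SkewPoly.IsProductOfIrreducibles (SkewPoly.central σ (Polynomial.X - 1)) n ∧
      ¬ IsSquare ((-1) ^ (1 * k * 1) * (Polynomial.X - 1 : Polynomial K).coeff 0 ^ (k * 1) *
        Algebra.norm K γ) ∧
      {g : SkewPoly σ | (Submodule.Quotient.mk g : SkewPoly.Quot σ (Polynomial.X - 1)) ∈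
          SkewPoly.codeD σ L' (Polynomial.X - 1) 1 k γ} =
        {g : SkewPoly σ | Submodule.Quotient.mk g ∈ SkewPoly.trombettiZhou σ L' k γ}) := by
  subst hn
  constructor
  · rintro F f s m ℓ hm hF hX rfl hprod rfl - hf ⟨g, hg⟩ - hkm hγ hsq
    have hF0 := coeff_zero_ne_zero_of_irreducible hm hF hX
    obtain ⟨q, ⟨b⟩⟩ := SkewPoly.exists_basis hf
    obtain rfl := SkewPoly.card_eq_of_isProductOfIrreducibles hσ hF hF0 hf hg b hprod
    obtain ⟨hn, hD⟩ := SkewPoly.eigenring_dimensions hσ hF hF0 hf hg b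
    refine ⟨hn, SkewPoly.exists_isCanonical hσ hF hF0 hf hg b, fun Φ => ?_⟩
    have := SkewPoly.isSimpleModule_of_irreducible hf
    have := eigenring_nontrivial (f := f) K
    have := SkewPoly.finite_eigenring (K := K) hf.ne_zero
    refine SkewPoly.isLinearMRDCode_image_codeD hσ (ht ▸ even_two_mul t) hm hF hL' ?_
      (eigenring_isUnit K) hn hD hk hkm hsq Φ
    rintro rfl
    exact hγ L'.zero_mem
  · intro _ hsq
    refine ⟨fun h => hsq (SkewPoly.norm_isSquare_of_mem hL' h),
      SkewPoly.isProductOfIrreducibles_X_sub_one hσ, ?_, ?_⟩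
    · have : (-1 : K) ^ k * (-1) ^ k = 1 := by rw [← mul_pow]; simp
      simpa [this] using hsq
    · have hdeg : (Polynomial.X - 1 : Polynomial K).natDegree = 1 := by
        rw [← Polynomial.C_1]
        exact Polynomial.natDegree_X_sub_C 1
      -- The two quotients are by the same left ideal written in two ways, so membership is compared
      -- through differences of representatives in `R`.
      ext g
      rw [Set.mem_ofPred_eq, Set.mem_ofPred_eq, SkewPoly.codeD, hdeg, one_mul, mul_one]
      constructor
      · rintro ⟨_, ⟨a, a', a'', rfl⟩, h⟩
        refine ⟨a, a', a'', ?_⟩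
        rw [Submodule.Quotient.eq, SkewPoly.central_X_sub_one] at h
        exact ((Submodule.Quotient.eq _).2 h).symm
      · rintro ⟨a, a', a'', h⟩
        refine ⟨_, ⟨a, a', a'', rfl⟩, ?_⟩
        rw [Submodule.Quotient.eq, ← SkewPoly.central_X_sub_one] at h
        exact ((Submodule.Quotient.eq _).2 h).symm
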